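/- Throughout, $\mathcal N(0,v)$ is the centred normal law with variance $v\ge 0$ (a point mass at $0$ if $v=0$), and $W_1$ is the $1$-Wasserstein distance between the laws of real random variables, $W_1(Y,Z)=\inf\mathbb E|Y'-Z'|$, the infimum running over all couplings $(Y',Z')$ of the laws of $Y$ and $Z$. **(1) The network.** Let $C_b\ge 0$, $C_W>0$, let $L\ge 1$ and $n_0,\dots,n_{L+1}\ge 1$ be integers, let $x\in\mathbb R^{n_0}$, and let $\sigma:\mathbb R\to\mathbb R$ be Borel measurable (for instance Lipschitz). Let $b^{(\ell)}_j\sim\mathcal N(0,C_b)$ and $W^{(\ell)}_{j,k}$ ($1\le\ell\le L+1$, $1\le j\le n_\ell$, $1\le k\le n_{\ell-1}$) be mutually independent random variables, the $W^{(\ell)}_{j,k}$ being copies of a random variable $W$ with $\mathbb E[W]=0$ and $\mathbb E[W^2]=1$. Put $$z^{(1)}_j(x)=b^{(1)}_j+\sqrt{\tfrac{C_W}{n_0}}\sum_{k=1}^{n_0}W^{(1)}_{j,k}x_k,\qquad z^{(\ell)}_j(x)=b^{(\ell)}_j+\sqrt{\tfrac{C_W}{n_{\ell-1}}}\sum_{k=1}^{n_{\ell-1}}W^{(\ell)}_{j,k}\,\sigma\big(z^{(\ell-1)}_k(x)\big)\quad(2\le\ell\le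 L+1),$$ and define the limiting variances by $$K^{(2)}=C_b+C_W\,\mathbb E\big[\sigma(z^{(1)}_1(x))^2\big],\qquad K^{(\ell+1)}=C_b+C_W\,\mathbb E\big[\sigma(G^{(\ell)})^2\big],\quad G^{(\ell)}\sim\mathcal N(0,K^{(\ell)})\quad(2\le \ell\le L).$$ (These expectations are finite if $\sigma$ is Lipschitz; for other $\sigma$, an infinite expectation in this recursion is to be replaced by $0$.) Let $$Q_2^{(L)}(x)=\mathbb E\Big[\Big|\sum_{j=1}^{n_L}\frac{C_W}{n_L}\sigma^2\big(z^{(L)}_j(x)\big)-K^{(L+1)}+C_b\Big|^2\Big].$$ If $\mathbb E[W^4]<\infty$, $\mathbb E[|\sigma(z^{(L)}_1(x))|^4]<\infty$ and $K^{(L+1)}\neq 0$, then for $G^{(L+1)}_1(x)\sim\mathcal N(0,K^{(L+1)})$ $$W_1\big(z^{(L+1)}_1(x),G^{(L+1)}_1(x)\big)\le\frac{C_W}{\sqrt{n_L}\sqrt{K^{(L+1)}}}\,\mathbb E[W^4]^{3/4}\Big(\mathbb E\big[|\sigma(z^{(L)}_1(x))|^4\big]^{3/4}+1\Big)\Big(\frac{4\sqrt{C_W}}{\sqrt{K^{(L+1)}}}+\frac1{\sqrt{2\pi}}\Big)+\sqrt{\frac{2}{\pi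 K^{(L+1)}}}\,\sqrt{Q_2^{(L)}(x)} .$$ **(2) Normal approximation with a Gaussian bias.** Let $C_b\ge0$, $K>0$, $k\ge 0$, let $E$ be a Polish space and $f:E^k\to\mathbb R$ measurable. Let $X=(X_1,\dots,X_k)$ be a random vector with independent $E$-valued components, $X'$ an independent copy of $X$, and $b\sim\mathcal N(0,C_b)$ independent of $(X,X')$. Assume $\mathbb E[f(X)]=0$ and $\mathbb E[f(X)^4]<\infty$. For $A\subseteq[k]=\{1,\dots,k\}$ let $X^A$ be $X$ with the components $X_i$, $i\in A$, replaced by $X'_i$; for $y\in E^k$ let $\Delta_jf(y)=f(y)-f(y_1,\dots,y_{j-1},X'_j,y_{j+1},\dots,y_k)$, and let $$T=\frac12\sum_{A\subsetneq[k]}\frac{1}{\binom{k}{|A|}(k-|A|)}\sum_{j\notin A}\Delta_jf(X)\,\Delta_jf(X^A).$$ Put $V=b+f(X)$ and let $N\sim\mathcal N(0,K)$. Then $$W_1(V,N)\le\sqrt{\frac{2}{\pi K}}\;\mathbb E\Big[\mathbb E\big[K-C_b-T\,\big|\,V\big]^2\Big]^{1/2}+\frac1{2K}\sum_{j=1}^k\mathbb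 E\big[|\Delta_jf(X)|^3\big].$$ -/

import Mathlib

open MeasureTheory ProbabilityTheory
open scoped ENNReal NNReal

noncomputable section

/-- The `1`-Wasserstein distance between two laws on the real line: the infimum of the mean
transport cost over all couplings. It takes values in `[0, ∞]`. -/
def wassersteinOne (μ ν : Measure ℝ) : ℝ≥0∞ :=
  ⨅ (π : Measure (ℝ × ℝ)) (_ : π.fst = μ) (_ : π.snd = ν), ∫⁻ p, edist p.1 p.2 ∂π

section Network

variable {Ω : Type*} [MeasurableSpace Ω]

/-- Indices of the parameters of a network with `L` hidden layers and widths `n 0, …, n (L + 1)`.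
The weights (left) and the biases (right) leading from layer `ℓ` to layer `ℓ + 1` have
the index `ℓ = 0, …, L`. -/
abbrev ParamIndex (L : ℕ) (n : ℕ → ℕ) : Type :=
  (Σ ℓ : Fin (L + 1), Fin (n (ℓ + 1)) × Fin (n ℓ)) ⊕ (Σ ℓ : Fin (L + 1), Fin (n (ℓ + 1)))

/-- The family of all weights and biases of the network. -/
def params (L : ℕ) (n : ℕ → ℕ) (W : (ℓ : ℕ) → Fin (n (ℓ + 1)) → Fin (n ℓ) → Ω → ℝ)
    (b : (ℓ : ℕ) → Fin (n (ℓ + 1)) → Ω → ℝ) : ParamIndex L n → Ω → ℝ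
  | Sum.inl q => W q.1 q.2.1 q.2.2
  | Sum.inr q => b q.1 q.2

/-- The random initialization: the biases have law `N(0, Cb)`, the weights have the law `ν` of
a generic centred variable of unit variance, and all of them are mutually independent. -/
structure IsRandomInit (P : Measure Ω) (L : ℕ) (n : ℕ → ℕ) (Cb : ℝ) (ν : Measure ℝ)
    (W : (ℓ : ℕ) → Fin (n (ℓ + 1)) → Fin (n ℓ) → Ω → ℝ)
    (b : (ℓ : ℕ) → Fin (n (ℓ + 1)) → Ω → ℝ) : Prop where
  mean_zero : ∫ w, w ∂ν = 0
  var_one : ∫ w, w ^ 2 ∂ν = 1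
  measurable_weight : ∀ ℓ ≤ L, ∀ j k, Measurable (W ℓ j k)
  measurable_bias : ∀ ℓ ≤ L, ∀ j, Measurable (b ℓ j)
  law_weight : ∀ ℓ ≤ L, ∀ j k, P.map (W ℓ j k) = ν
  law_bias : ∀ ℓ ≤ L, ∀ j, P.map (b ℓ j) = gaussianReal 0 Cb.toNNReal
  indep : iIndepFun (params L n W b) P

/-- `preact σ CW n W b x ℓ j` is the `j`-th entry of the vector `z^(ℓ)(x)` for `ℓ ≥ 1`; the layer
`0` is the input itself. -/
def preact (σ : ℝ → ℝ) (CW : ℝ) (n : ℕ → ℕ)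
    (W : (ℓ : ℕ) → Fin (n (ℓ + 1)) → Fin (n ℓ) → Ω → ℝ)
    (b : (ℓ : ℕ) → Fin (n (ℓ + 1)) → Ω → ℝ) (x : Fin (n 0) → ℝ) :
    (ℓ : ℕ) → Fin (n ℓ) → Ω → ℝ
  | 0 => fun j _ => x j
  | 1 => fun j ω => b 0 j ω + √CW / √(n 0) * ∑ k, W 0 j k ω * x k
  | ℓ + 2 => fun j ω => b (ℓ + 1) j ω +
      √CW / √(n (ℓ + 1)) * ∑ k, W (ℓ + 1) j k ω * σ (preact σ CW n W b x (ℓ + 1) k ω)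

variable (P : Measure Ω) (σ : ℝ → ℝ) (Cb CW : ℝ) (n : ℕ → ℕ) [∀ ℓ, NeZero (n ℓ)]
  (W : (ℓ : ℕ) → Fin (n (ℓ + 1)) → Fin (n ℓ) → Ω → ℝ)
  (b : (ℓ : ℕ) → Fin (n (ℓ + 1)) → Ω → ℝ) (x : Fin (n 0) → ℝ)

/-- `limitVar P σ Cb CW n W b x ℓ` is the infinite-width variance `K^(ℓ)` for `ℓ ≥ 2` (the values
at `0` and `1` are placeholders):
`K^(2) = Cb + CW * E[σ(z_1^(1)(x))^2]` and `K^(ℓ+1) = Cb + CW * E[σ(G)^2]`, `G ∼ N(0, K^(ℓ))`. -/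
def limitVar : ℕ → ℝ
  | 0 => 0
  | 1 => 0
  | 2 => Cb + CW * ∫ ω, σ (preact σ CW n W b x 1 0 ω) ^ 2 ∂P
  | ℓ + 3 => Cb + CW * ∫ g, σ g ^ 2 ∂(gaussianReal 0 (limitVar (ℓ + 2)).toNNReal)

/-- `Q_p^(ℓ)(x)`. -/
def fluctuation (p ℓ : ℕ) : ℝ :=
  ∫ ω, |(∑ j, CW / (n ℓ) * σ (preact σ CW n W b x ℓ j ω) ^ 2)
      - limitVar P σ Cb CW n W b x (ℓ + 1) + Cb| ^ p ∂P

end Network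

section Resampling

variable {E : Type*} {k : ℕ}

/-- `x^A`: the coordinates in `A` are taken from `x'`, the other ones from `x`. -/
def resample (x x' : Fin k → E) (A : Finset (Fin k)) : Fin k → E :=
  fun i => if i ∈ A then x' i else x i

/-- `Δ_j f` at the point `y`, the `j`-th coordinate being replaced by that of `x'`. -/
def discreteDiff (f : (Fin k → E) → ℝ) (x' : Fin k → E) (j : Fin k) (y : Fin k → E) : ℝ :=
  f y - f (Function.update y j (x' j))

/-- The statistic `T`, a sum over the proper subsets `A` of the index set. -/
def steinT (f : (Fin k → E) → ℝ) (x x' : Fin k → E) : ℝ :=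
  1 / 2 * ∑ A ∈ (Finset.univ : Finset (Fin k)).ssubsets,
    1 / ((k.choose A.card : ℝ) * ((k : ℝ) - A.card)) *
      ∑ j ∈ Aᶜ, discreteDiff f x' j x * discreteDiff f x' j (resample x x' A)

end Resampling

end

/-!
By Kantorovich duality on the line, `W₁(V, N(0, K))` is the supremum of
`E[h V] - ∫ h ∂N(0, K)` over the `1`-Lipschitz functions `h`, and Stein's equation rewrites this
difference as `E[K g'(V) - V g(V)]` with `|g'| ≤ √(2 / (K π))` and `g'` Lipschitz with constant
`2 / K`. If `V = b + U` with a Gaussian bias `b` of variance `v`, then Gaussian integration by parts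
turns `E[b g(V)]` into `v E[g'(V)]`, so that `E[(K - v) g'(V) - U g(V)]` is to be bounded.

For `U = f(X)` the increments of `f` along the chains of subsets from `∅` to `[k]` telescope to
`f(X) - f(X')`, and `f(X')` is independent of `V` and centred. Exchanging `X j` and `X' j`
symmetrizes each of these increments, and Taylor's formula replaces `E[U g(V)]` by `E[T g'(V)]` at
the cost of the third moments of the `Δ_j f` (Chatterjee's method).

For the output `V = b + ∑ a_j W_j` of a network, the weights `W_j` of the last layer are independent
of the activations `a_j`. Expanding `g(V)` around the value of `V` without the `j`-th summand
replaces `E[U g(V)]` by `E[∑ a_j² W_j² g'(V)]`. The terms `a_j² (W_j² - 1)` are uncorrelated, so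
that passing to `∑ a_j²` costs only their variances, and what remains is the fluctuation of
`∑ a_j²` around `K - v`.
-/

section

open Filter Topology Set

theorem nonneg_of_hasDerivAt_nonneg_of_tendsto_atBot {u u' : ℝ → ℝ} {a : ℝ}
    (hu : ∀ x ≤ a, HasDerivAt u (u' x) x) (hu' : ∀ x ≤ a, 0 ≤ u' x)
    (hlim : Tendsto u atBot (𝓝 0)) : 0 ≤ u a := by
  have hmono : MonotoneOn u (Iic a) :=
    monotoneOn_of_hasDerivWithinAt_nonneg (convex_Iic a)
      (fun x hx => (hu x hx).continuousAt.continuousWithinAt)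
      (fun x hx => (hu x (mem_Iic.1 (interior_subset hx))).hasDerivWithinAt)
      (fun x hx => hu' x (mem_Iic.1 (interior_subset hx)))
  refine le_of_tendsto hlim ?_
  filter_upwards [eventually_le_atBot a] with x hx
  exact hmono hx self_mem_Iic hx

theorem hasDerivAt_integral_Iic {f : ℝ → ℝ} (hf : Continuous f) (hi : ∀ w, IntegrableOn f (Iic w))
    (w : ℝ) : HasDerivAt (fun w => ∫ x in Iic w, f x) (f w) w := by
  have h : (fun w => ∫ x in Iic w, f x) =
      fun w => (∫ x in Iic 0, f x) + ∫ x in (0 : ℝ)..w, f x := by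
    ext w
    rw [← intervalIntegral.integral_Iic_sub_Iic (hi 0) (hi w)]
    ring
  rw [h]
  exact (intervalIntegral.integral_hasDerivAt_right (hf.intervalIntegrable _ _)
    (hf.stronglyMeasurableAtFilter _ _) hf.continuousAt).const_add _

theorem hasDerivAt_gaussianPDFReal (μ : ℝ) {v : ℝ≥0} (hv : v ≠ 0) (x : ℝ) :
    HasDerivAt (gaussianPDFReal μ v) (-((x - μ) / v * gaussianPDFReal μ v x)) x := by
  have h : HasDerivAt (fun x : ℝ => -(x - μ) ^ 2 / (2 * v)) (-(2 * (x - μ)) / (2 * v)) x := by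
    simpa using (((hasDerivAt_id x).sub_const μ).pow 2).neg.div_const (2 * (v : ℝ))
  rw [gaussianPDFReal_def]
  refine (h.exp.const_mul (√(2 * Real.pi * v))⁻¹).congr_deriv ?_
  have : (v : ℝ) ≠ 0 := by exact_mod_cast hv
  field_simp

namespace StdNormal

/-- The standard normal density. -/
noncomputable def pdf (w : ℝ) : ℝ := gaussianPDFReal 0 1 w

/-- The standard normal distribution function. -/
noncomputable def cdf (w : ℝ) : ℝ := ∫ x in Iic w, pdf x

/-- The mean `E (w - Z)⁺` of the positive part of `w - Z` for a standard normal `Z`, in closed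
form; it is the integral of `cdf` over the half-line below `w`. -/
noncomputable def excess (w : ℝ) : ℝ := w * cdf w + pdf w

theorem pdf_eq (w : ℝ) : pdf w = (√(2 * Real.pi))⁻¹ * Real.exp (-w ^ 2 / 2) := by
  simp [pdf, gaussianPDFReal_def]

theorem pdf_pos (w : ℝ) : 0 < pdf w := gaussianPDFReal_pos 0 1 w one_ne_zero

theorem pdf_neg (w : ℝ) : pdf (-w) = pdf w := by simp [pdf_eq]

theorem pdf_le_pdf_zero (w : ℝ) : pdf w ≤ pdf 0 := by
  rw [pdf_eq, pdf_eq]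
  gcongr ?_ * Real.exp ?_
  nlinarith [sq_nonneg w]

theorem two_mul_pdf_zero : 2 * pdf 0 = √(2 / Real.pi) := by
  have h2 : √2 * √2 = (2 : ℝ) := Real.mul_self_sqrt zero_le_two
  have : 0 < √Real.pi := Real.sqrt_pos.2 Real.pi_pos
  rw [pdf_eq, Real.sqrt_mul zero_le_two, Real.sqrt_div zero_le_two]
  field_simp
  simp [pow_two, h2]

theorem hasDerivAt_pdf (w : ℝ) : HasDerivAt pdf (-(w * pdf w)) w := by
  refine (hasDerivAt_gaussianPDFReal 0 one_ne_zero w).congr_deriv ?_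
  simp [pdf]

theorem continuous_pdf : Continuous pdf :=
  continuous_iff_continuousAt.2 fun w => (hasDerivAt_pdf w).continuousAt

theorem integrable_pdf : Integrable pdf := integrable_gaussianPDFReal 0 1

theorem integral_pdf : ∫ x, pdf x = 1 := integral_gaussianPDFReal_eq_one 0 one_ne_zero

theorem tendsto_pow_mul_pdf_atBot (k : ℕ) : Tendsto (fun w => w ^ k * pdf w) atBot (𝓝 0) := by
  have h := ((tendsto_rpow_abs_mul_exp_neg_mul_sq_cocompact one_half_pos k).mono_left
    atBot_le_cocompact).const_mul (√(2 * Real.pi))⁻¹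
  rw [mul_zero] at h
  refine squeeze_zero_norm (fun w => le_of_eq ?_) h
  rw [norm_mul, norm_pow, Real.norm_eq_abs, Real.norm_of_nonneg (pdf_pos w).le, pdf_eq,
    Real.rpow_natCast]
  ring_nf

theorem tendsto_pdf_atBot : Tendsto pdf atBot (𝓝 0) := by
  simpa using tendsto_pow_mul_pdf_atBot 0

theorem cdf_nonneg (w : ℝ) : 0 ≤ cdf w := integral_nonneg fun x => (pdf_pos x).le

theorem cdf_neg (w : ℝ) : cdf (-w) = 1 - cdf w := by
  have hneg : cdf (-w) = ∫ x in Ioi w, pdf x := by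
    have h := integral_comp_neg_Ioi w pdf
    simp only [pdf_neg] at h
    exact h.symm
  have hadd := intervalIntegral.integral_Iic_add_Ioi (b := w) (f := pdf) (μ := volume)
    integrable_pdf.integrableOn integrable_pdf.integrableOn
  rw [integral_pdf] at hadd
  rw [hneg, cdf]
  linarith

theorem cdf_le_one (w : ℝ) : cdf w ≤ 1 := by
  have := cdf_nonneg (-w)
  rw [cdf_neg] at this
  linarith

theorem hasDerivAt_cdf (w : ℝ) : HasDerivAt cdf (pdf w) w :=
  hasDerivAt_integral_Iic continuous_pdf (fun _ => integrable_pdf.integrableOn) w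

theorem continuous_cdf : Continuous cdf :=
  continuous_iff_continuousAt.2 fun w => (hasDerivAt_cdf w).continuousAt

theorem tendsto_cdf_atBot : Tendsto cdf atBot (𝓝 0) := tendsto_integral_Iic_zero tendsto_id

theorem excess_neg (w : ℝ) : excess (-w) = pdf w - w * (1 - cdf w) := by
  rw [excess, cdf_neg, pdf_neg]
  ring

theorem hasDerivAt_excess (w : ℝ) : HasDerivAt excess (cdf w) w := by
  refine (((hasDerivAt_id w).mul (hasDerivAt_cdf w)).add (hasDerivAt_pdf w)).congr_deriv ?_
  simp

theorem hasDerivAt_excess_neg (w : ℝ) : HasDerivAt (fun w => excess (-w)) (-(1 - cdf w)) w := by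
  refine ((hasDerivAt_excess (-w)).scomp w (hasDerivAt_neg w)).congr_deriv ?_
  simp [cdf_neg]

theorem excess_nonneg (w : ℝ) : 0 ≤ excess w := by
  refine nonneg_of_hasDerivAt_nonneg_of_tendsto_atBot (u := fun x => w * cdf x + pdf x)
    (u' := fun x => (w - x) * pdf x) (fun x _ => ?_)
    (fun x hx => mul_nonneg (sub_nonneg.2 hx) (pdf_pos x).le) ?_
  · exact (((hasDerivAt_cdf x).const_mul w).add (hasDerivAt_pdf x)).congr_deriv (by ring)
  · simpa using (tendsto_cdf_atBot.const_mul w).add tendsto_pdf_atBot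

theorem tendsto_excess_atBot : Tendsto excess atBot (𝓝 0) := by
  refine squeeze_zero' (Eventually.of_forall excess_nonneg) ?_ tendsto_pdf_atBot
  filter_upwards [eventually_le_atBot 0] with w hw
  have := mul_nonpos_of_nonpos_of_nonneg hw (cdf_nonneg w)
  rw [excess]
  linarith

theorem neg_mul_pdf_le (w : ℝ) : -(w * pdf w) ≤ (1 + w ^ 2) * cdf w := by
  have h := nonneg_of_hasDerivAt_nonneg_of_tendsto_atBot (a := w)
    (u := fun x => (1 + w ^ 2) * cdf x + (2 * w - x) * pdf x)
    (u' := fun x => (w - x) ^ 2 * pdf x) (fun x _ => ?_)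
    (fun x _ => mul_nonneg (sq_nonneg _) (pdf_pos x).le) ?_
  · linarith
  · refine (((hasDerivAt_cdf x).const_mul (1 + w ^ 2)).add
      (((hasDerivAt_id x).const_sub (2 * w)).mul (hasDerivAt_pdf x))).congr_deriv ?_
    simp only [id]
    ring
  · have h := (tendsto_cdf_atBot.const_mul (1 + w ^ 2)).add
      ((tendsto_pdf_atBot.const_mul (2 * w)).sub (tendsto_pow_mul_pdf_atBot 1))
    simpa [sub_mul] using h

theorem mul_pdf_le (w : ℝ) : w * pdf w ≤ (1 + w ^ 2) * (1 - cdf w) := by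
  simpa [cdf_neg, pdf_neg] using neg_mul_pdf_le (-w)

theorem one_sub_cdf_mul_excess_add (w : ℝ) :
    (1 - cdf w) * excess w + cdf w * excess (-w) = pdf w := by
  rw [excess_neg, excess]
  ring

theorem two_mul_cdf_sub_one_ge {w : ℝ} (hw : w ≤ 0) : 2 * w * pdf 0 ≤ 2 * cdf w - 1 := by
  have hderiv (x : ℝ) : HasDerivAt (fun w => 2 * cdf w - 1 - 2 * w * pdf 0)
      (2 * pdf x - 2 * pdf 0) x :=
    ((((hasDerivAt_cdf x).const_mul 2).sub_const 1).sub
      (((hasDerivAt_id x).const_mul 2).mul_const (pdf 0))).congr_deriv (by simp)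
  have hanti := antitone_of_hasDerivAt_nonpos hderiv fun x =>
    sub_nonpos.2 (mul_le_mul_of_nonneg_left (pdf_le_pdf_zero x) zero_le_two)
  have hzero : cdf 0 = 1 - cdf 0 := by simpa using cdf_neg 0
  have := hanti hw
  simp only [mul_zero, zero_mul] at this
  linarith

theorem mul_two_mul_cdf_sub_one_add_le {w : ℝ} (hw : w ≤ 0) :
    w * (2 * cdf w - 1) + 2 * pdf w ≤ (2 + w ^ 2) * pdf 0 := by
  have hderiv (x : ℝ) : HasDerivAt (fun w => w * (2 * cdf w - 1) + 2 * pdf w - (2 + w ^ 2) * pdf 0)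
      (2 * cdf x - 1 - 2 * x * pdf 0) x := by
    refine ((((hasDerivAt_id x).mul (((hasDerivAt_cdf x).const_mul 2).sub_const 1)).add
      ((hasDerivAt_pdf x).const_mul 2)).sub
      (((hasDerivAt_pow 2 x).const_add 2).mul_const (pdf 0))).congr_deriv ?_
    simp only [id]
    ring
  have hmono : MonotoneOn (fun w => w * (2 * cdf w - 1) + 2 * pdf w - (2 + w ^ 2) * pdf 0)
      (Iic 0) :=
    monotoneOn_of_hasDerivWithinAt_nonneg (convex_Iic 0)
      (fun x _ => (hderiv x).continuousAt.continuousWithinAt)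
      (fun x _ => (hderiv x).hasDerivWithinAt)
      (fun x hx => sub_nonneg.2 (two_mul_cdf_sub_one_ge (mem_Iic.1 (interior_subset hx))))
  have := hmono hw self_mem_Iic hw
  norm_num at this
  linarith

theorem tendsto_excess_mul_excess_neg_div_sq_atBot :
    Tendsto (fun w => excess w * excess (-w) / w ^ 2) atBot (𝓝 0) := by
  have hinv := tendsto_inv_atBot_zero (𝕜 := ℝ)
  have h := tendsto_excess_atBot.mul ((tendsto_excess_atBot.mul (hinv.pow 2)).sub hinv)
  refine Tendsto.congr' ?_ (by simpa using h)
  filter_upwards [eventually_lt_atBot 0] with w hw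
  have : w ≠ 0 := hw.ne
  have : excess (-w) = excess w - w := by
    rw [excess_neg, excess]
    ring
  rw [this]
  field_simp

theorem excess_mul_excess_neg_le_of_neg {w : ℝ} (hw : w < 0) :
    excess w * excess (-w) ≤ pdf 0 * pdf w := by
  have h := nonneg_of_hasDerivAt_nonneg_of_tendsto_atBot (a := w)
    (u := fun x => (pdf 0 * pdf x - excess x * excess (-x)) / x ^ 2)
    (u' := fun x => pdf x * (x * (2 * cdf x - 1) + 2 * pdf x - (2 + x ^ 2) * pdf 0) / x ^ 3)
    (fun x hx => ?_) (fun x hx => ?_) ?_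
  · rw [le_div_iff₀ (sq_pos_of_neg hw), zero_mul] at h
    linarith
  · have hx0 : x ≠ 0 := (hx.trans_lt hw).ne
    refine ((((hasDerivAt_pdf x).const_mul (pdf 0)).sub ((hasDerivAt_excess x).mul
      (hasDerivAt_excess_neg x))).div (hasDerivAt_pow 2 x) (pow_ne_zero 2 hx0)).congr_deriv ?_
    simp only [Pi.mul_apply, Pi.sub_apply, excess, cdf_neg, pdf_neg]
    field_simp
    ring
  · have hx0 : x < 0 := hx.trans_lt hw
    exact div_nonneg_of_nonpos (mul_nonpos_of_nonneg_of_nonpos (pdf_pos x).le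
      (sub_nonpos.2 (mul_two_mul_cdf_sub_one_add_le hx0.le))) (Odd.pow_neg (by decide) hx0).le
  · have hpdf := (tendsto_pdf_atBot.const_mul (pdf 0)).mul
      ((tendsto_inv_atBot_zero (𝕜 := ℝ)).pow 2)
    simpa [sub_mul, div_eq_mul_inv] using hpdf.sub
      tendsto_excess_mul_excess_neg_div_sq_atBot

theorem excess_mul_excess_neg_le (w : ℝ) : excess w * excess (-w) ≤ pdf 0 * pdf w := by
  rcases lt_trichotomy w 0 with hw | rfl | hw
  · exact excess_mul_excess_neg_le_of_neg hw
  · simp [excess]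
  · have h := excess_mul_excess_neg_le_of_neg (neg_neg_of_pos hw)
    rwa [neg_neg, pdf_neg, mul_comm (excess _)] at h

theorem integrableOn_cdf (w : ℝ) : IntegrableOn cdf (Iic w) :=
  integrableOn_Iic_of_intervalIntegral_norm_bounded (a := id) (l := atBot) (excess w) w
    (fun _ => continuous_cdf.integrableOn_Ioc) tendsto_id <| Eventually.of_forall fun i => by
      simp only [Real.norm_of_nonneg (cdf_nonneg _)]
      rw [intervalIntegral.integral_eq_sub_of_hasDerivAt
        (fun x _ => hasDerivAt_excess x) (continuous_cdf.intervalIntegrable _ _)]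
      exact sub_le_self _ (excess_nonneg i)

theorem integral_Iic_cdf (w : ℝ) : ∫ x in Iic w, cdf x = excess w := by
  simpa using integral_Iic_of_hasDerivAt_of_tendsto' (a := w)
    (fun x _ => hasDerivAt_excess x) (integrableOn_cdf w) tendsto_excess_atBot

end StdNormal

theorem abs_sub_sub_deriv_mul_le {g : ℝ → ℝ} {M : ℝ≥0} (hg : Differentiable ℝ g)
    (hM : LipschitzWith M (deriv g)) (y z : ℝ) :
    |g y - g z - deriv g y * (y - z)| ≤ M / 2 * (y - z) ^ 2 := by
  have hlip (t : ℝ) (ht : 0 ≤ t) :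
      ‖deriv g (y + t * (z - y)) * (z - y) - deriv g y * (z - y)‖ ≤
        M / 2 * (z - y) ^ 2 * (2 * t) := by
    have h := hM.dist_le_mul (y + t * (z - y)) y
    rw [Real.dist_eq, Real.dist_eq, add_sub_cancel_left, abs_mul, abs_of_nonneg ht] at h
    rw [← sub_mul, norm_mul, Real.norm_eq_abs, Real.norm_eq_abs]
    calc |deriv g (y + t * (z - y)) - deriv g y| * |z - y|
        ≤ M * (t * |z - y|) * |z - y| := by gcongr
      _ = M * t * |z - y| ^ 2 := by ring
      _ = M / 2 * (z - y) ^ 2 * (2 * t) := by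
        rw [sq_abs]
        ring
  have hline (t : ℝ) : HasDerivAt (fun t : ℝ => y + t * (z - y)) (z - y) t := by
    simpa using ((hasDerivAt_id t).mul_const (z - y)).const_add y
  have hderiv (t : ℝ) : HasDerivAt (fun t => g (y + t * (z - y)) - g y - t * (deriv g y * (z - y)))
      (deriv g (y + t * (z - y)) * (z - y) - deriv g y * (z - y)) t := by
    have h := (((hg _).hasDerivAt.comp t (hline t)).sub_const (g y)).sub
      ((hasDerivAt_id' t).mul_const (deriv g y * (z - y)))
    exact h.congr_deriv (by ring)
  have h := image_norm_le_of_norm_deriv_right_le_deriv_boundary (a := 0) (b := 1)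
    (B := fun t => M / 2 * (z - y) ^ 2 * t ^ 2)
    (fun t _ => (hderiv t).continuousAt.continuousWithinAt) (fun t _ => (hderiv t).hasDerivWithinAt)
    (by simp) (fun t => by simpa using (hasDerivAt_pow 2 t).const_mul (M / 2 * (z - y) ^ 2))
    (fun t ht => hlip t ht.1) (right_mem_Icc.2 zero_le_one)
  rw [Real.norm_eq_abs, one_mul, one_mul, add_sub_cancel, one_pow, mul_one] at h
  rw [← abs_neg, ← neg_sub z y, neg_sq]
  convert h using 2
  ring

theorem deriv_comp_div_const (g : ℝ → ℝ) (c w : ℝ) :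
    deriv (fun w => g (w / c)) w = deriv g (w / c) / c := by
  simpa [div_eq_inv_mul] using deriv_comp_mul_left c⁻¹ g w

theorem abs_mul_add_mul_le {x y p q a c : ℝ} (hx : |x| ≤ p) (hy : |y| ≤ q) (ha : 0 ≤ a)
    (hc : 0 ≤ c) : |x * a + y * c| ≤ p * a + q * c := by
  refine (abs_add_le _ _).trans ?_
  rw [abs_mul, abs_mul, abs_of_nonneg ha, abs_of_nonneg hc]
  gcongr

/-- The functions through which Stein's method tests the proximity to `N(0, K)`: the bounds are
those satisfied by the solutions `g` of `K * g' w - w * g w = h w - E h(N)` for `1`-Lipschitz `h`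
(see `exists_isSteinFunction`). -/
structure IsSteinFunction (K : ℝ) (g : ℝ → ℝ) : Prop where
  differentiable : Differentiable ℝ g
  abs_le_one : ∀ w, |g w| ≤ 1
  abs_deriv_le : ∀ w, |deriv g w| ≤ √(2 / (K * Real.pi))
  lipschitzWith_deriv : LipschitzWith (2 / K).toNNReal (deriv g)

namespace IsSteinFunction

variable {K : ℝ} {g : ℝ → ℝ}

theorem continuous (hg : IsSteinFunction K g) : Continuous g := hg.differentiable.continuous

theorem continuous_deriv (hg : IsSteinFunction K g) : Continuous (deriv g) :=
  hg.lipschitzWith_deriv.continuous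

theorem abs_taylor_le (hg : IsSteinFunction K g) (hK : 0 < K) (y z : ℝ) :
    |g y - g z - deriv g y * (y - z)| ≤ 1 / K * (y - z) ^ 2 := by
  have h := abs_sub_sub_deriv_mul_le hg.differentiable hg.lipschitzWith_deriv y z
  rwa [Real.coe_toNNReal _ (by positivity), div_right_comm, div_self two_ne_zero] at h

theorem comp_div_sqrt (hg : IsSteinFunction 1 g) (hK : 0 < K) :
    IsSteinFunction K (fun w => g (w / √K)) := by
  have hs : 0 < √K := Real.sqrt_pos.2 hK
  have hderiv : deriv (fun w => g (w / √K)) = fun w => deriv g (w / √K) / √K :=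
    funext (deriv_comp_div_const g √K)
  refine ⟨hg.differentiable.comp (differentiable_id.div_const _), fun w => hg.abs_le_one _,
    fun w => ?_, ?_⟩
  · rw [hderiv, abs_div, abs_of_pos hs, mul_comm K, ← div_div, Real.sqrt_div (by positivity)]
    gcongr
    simpa using hg.abs_deriv_le (w / √K)
  · rw [hderiv]
    refine LipschitzWith.of_dist_le_mul fun x y => ?_
    have h := hg.lipschitzWith_deriv.dist_le_mul (x / √K) (y / √K)
    rw [Real.coe_toNNReal _ (by positivity)] at h ⊢
    rw [Real.dist_eq, Real.dist_eq, ← sub_div, abs_div, abs_of_pos hs] at h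
    rw [Real.dist_eq, Real.dist_eq, ← sub_div, abs_div, abs_of_pos hs, div_le_iff₀ hs]
    refine h.trans (le_of_eq ?_)
    field_simp
    rw [Real.sq_sqrt hK.le]

end IsSteinFunction

namespace StdNormal

/-- The integral of `φ` against the normal distribution function over the half-line below `w`. -/
noncomputable def lowerIntegral (φ : ℝ → ℝ) (w : ℝ) : ℝ := ∫ x in Iic w, φ x * cdf x

/-- The integral of `φ` against the normal tail function over the half-line above `w`, encoded as a
lower integral through the symmetry `1 - cdf x = cdf (-x)`. -/
noncomputable def upperIntegral (φ : ℝ → ℝ) (w : ℝ) : ℝ := lowerIntegral (fun x => φ (-x)) (-w)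

/-- The bounded solution `g` of Stein's equation `g' w - w * g w = h w - ∫ h dN(0,1)`, where
`h' = φ`. -/
noncomputable def steinSolution (φ : ℝ → ℝ) (w : ℝ) : ℝ :=
  -((1 - cdf w) * lowerIntegral φ w + cdf w * upperIntegral φ w) / pdf w

/-- The derivative of `steinSolution φ`. -/
noncomputable def steinSolutionDeriv (φ : ℝ → ℝ) (w : ℝ) : ℝ :=
  w * steinSolution φ w + (lowerIntegral φ w - upperIntegral φ w)

section SteinSolution

variable {φ : ℝ → ℝ} (hφ : Continuous φ) (hb : ∀ x, |φ x| ≤ 1)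
include hφ hb

theorem integrableOn_mul_cdf (w : ℝ) : IntegrableOn (fun x => φ x * cdf x) (Iic w) :=
  (integrableOn_cdf w).bdd_mul (c := 1) hφ.aestronglyMeasurable (Eventually.of_forall hb)

theorem hasDerivAt_lowerIntegral (w : ℝ) : HasDerivAt (lowerIntegral φ) (φ w * cdf w) w :=
  hasDerivAt_integral_Iic (hφ.mul continuous_cdf) (integrableOn_mul_cdf hφ hb) w

theorem hasDerivAt_upperIntegral (w : ℝ) :
    HasDerivAt (upperIntegral φ) (-(φ w * (1 - cdf w))) w := by
  have h := (hasDerivAt_lowerIntegral (hφ.comp continuous_neg) (fun x => hb (-x)) (-w)).scomp w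
    (hasDerivAt_neg w)
  refine h.congr_deriv ?_
  simp [cdf_neg]

theorem hasDerivAt_lowerIntegral_sub_upperIntegral (w : ℝ) :
    HasDerivAt (fun w => lowerIntegral φ w - upperIntegral φ w) (φ w) w :=
  ((hasDerivAt_lowerIntegral hφ hb w).sub (hasDerivAt_upperIntegral hφ hb w)).congr_deriv (by ring)

theorem abs_lowerIntegral_le (w : ℝ) : |lowerIntegral φ w| ≤ excess w := by
  rw [← integral_Iic_cdf]
  refine abs_integral_le_integral_abs.trans ?_
  refine integral_mono (integrableOn_mul_cdf hφ hb w).abs (integrableOn_cdf w) fun x => ?_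
  simp only [abs_mul, abs_of_nonneg (cdf_nonneg x)]
  exact mul_le_of_le_one_left (cdf_nonneg x) (hb x)

theorem abs_upperIntegral_le (w : ℝ) : |upperIntegral φ w| ≤ excess (-w) :=
  abs_lowerIntegral_le (hφ.comp continuous_neg) (fun x => hb (-x)) (-w)

theorem hasDerivAt_steinSolution (w : ℝ) :
    HasDerivAt (steinSolution φ) (steinSolutionDeriv φ w) w := by
  have hp := pdf_pos w
  have h := ((((hasDerivAt_cdf w).const_sub 1).mul (hasDerivAt_lowerIntegral hφ hb w)).add
    ((hasDerivAt_cdf w).mul (hasDerivAt_upperIntegral hφ hb w))).neg.div (hasDerivAt_pdf w) hp.ne'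
  refine h.congr_deriv ?_
  simp only [Pi.add_apply, Pi.mul_apply, Pi.neg_apply, steinSolutionDeriv, steinSolution]
  field_simp
  ring

theorem deriv_steinSolution : deriv (steinSolution φ) = steinSolutionDeriv φ :=
  deriv_eq fun w => hasDerivAt_steinSolution hφ hb w

theorem hasDerivAt_steinSolutionDeriv (w : ℝ) : HasDerivAt (steinSolutionDeriv φ)
    (steinSolution φ w + w * steinSolutionDeriv φ w + φ w) w := by
  refine (((hasDerivAt_id w).mul (hasDerivAt_steinSolution hφ hb w)).add
    (hasDerivAt_lowerIntegral_sub_upperIntegral hφ hb w)).congr_deriv ?_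
  simp

theorem abs_steinSolution_le (w : ℝ) : |steinSolution φ w| ≤ 1 := by
  have hp := pdf_pos w
  rw [steinSolution, abs_div, abs_neg, abs_of_pos hp, div_le_one hp, mul_comm (1 - _),
    mul_comm (cdf w)]
  refine (abs_mul_add_mul_le (abs_lowerIntegral_le hφ hb w) (abs_upperIntegral_le hφ hb w)
    (sub_nonneg.2 (cdf_le_one w)) (cdf_nonneg w)).trans (le_of_eq ?_)
  rw [mul_comm (excess w), mul_comm (excess (-w)), one_sub_cdf_mul_excess_add]

theorem abs_steinSolutionDeriv_le (w : ℝ) : |steinSolutionDeriv φ w| ≤ √(2 / Real.pi) := by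
  have hp := pdf_pos w
  have heq : steinSolutionDeriv φ w =
      (lowerIntegral φ w * excess (-w) + -upperIntegral φ w * excess w) / pdf w := by
    rw [steinSolutionDeriv, steinSolution, excess_neg, excess]
    field_simp
    ring
  rw [heq, abs_div, abs_of_pos hp, div_le_iff₀ hp, ← two_mul_pdf_zero]
  calc |lowerIntegral φ w * excess (-w) + -upperIntegral φ w * excess w|
      ≤ excess w * excess (-w) + excess (-w) * excess w :=
        abs_mul_add_mul_le (abs_lowerIntegral_le hφ hb w)
          ((abs_neg _).trans_le (abs_upperIntegral_le hφ hb w)) (excess_nonneg _) (excess_nonneg _)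
    _ = 2 * (excess w * excess (-w)) := by ring
    _ ≤ 2 * (pdf 0 * pdf w) := mul_le_mul_of_nonneg_left (excess_mul_excess_neg_le w) zero_le_two
    _ = 2 * pdf 0 * pdf w := by ring

theorem abs_deriv_steinSolutionDeriv_le (w : ℝ) :
    |steinSolution φ w + w * steinSolutionDeriv φ w + φ w| ≤ 2 := by
  have hp := pdf_pos w
  have heq : steinSolution φ w + w * steinSolutionDeriv φ w =
      -(lowerIntegral φ w * ((1 + w ^ 2) * (1 - cdf w) - w * pdf w) +
        upperIntegral φ w * ((1 + w ^ 2) * cdf w + w * pdf w)) / pdf w := by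
    rw [steinSolutionDeriv, steinSolution]
    field_simp
    ring
  have hle : |steinSolution φ w + w * steinSolutionDeriv φ w| ≤ 1 := by
    rw [heq, abs_div, abs_neg, abs_of_pos hp, div_le_one hp]
    refine (abs_mul_add_mul_le (abs_lowerIntegral_le hφ hb w) (abs_upperIntegral_le hφ hb w)
      (sub_nonneg.2 (mul_pdf_le w)) (neg_le_iff_add_nonneg.1 (neg_mul_pdf_le w))).trans
      (le_of_eq ?_)
    rw [excess_neg, excess]
    ring
  linarith [abs_add_le (steinSolution φ w + w * steinSolutionDeriv φ w) (φ w), hb w]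

theorem isSteinFunction_steinSolution : IsSteinFunction 1 (steinSolution φ) where
  differentiable w := (hasDerivAt_steinSolution hφ hb w).differentiableAt
  abs_le_one := abs_steinSolution_le hφ hb
  abs_deriv_le w := by
    rw [deriv_steinSolution hφ hb, one_mul]
    exact abs_steinSolutionDeriv_le hφ hb w
  lipschitzWith_deriv := by
    rw [deriv_steinSolution hφ hb]
    refine lipschitzWith_of_nnnorm_deriv_le
      (fun w => (hasDerivAt_steinSolutionDeriv hφ hb w).differentiableAt) fun w => ?_
    rw [(hasDerivAt_steinSolutionDeriv hφ hb w).deriv, ← NNReal.coe_le_coe, coe_nnnorm,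
      Real.norm_eq_abs, Real.coe_toNNReal _ (by norm_num), div_one]
    exact abs_deriv_steinSolutionDeriv_le hφ hb w

theorem exists_steinEquation : ∃ c, ∀ w,
    deriv (steinSolution φ) w - w * steinSolution φ w = (∫ t in (0 : ℝ)..w, φ t) - c := by
  refine ⟨upperIntegral φ 0 - lowerIntegral φ 0, fun w => ?_⟩
  rw [deriv_steinSolution hφ hb, intervalIntegral.integral_eq_sub_of_hasDerivAt
    (fun x _ => hasDerivAt_lowerIntegral_sub_upperIntegral hφ hb x) (hφ.intervalIntegrable _ _),
    steinSolutionDeriv]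
  ring

end SteinSolution

end StdNormal

theorem exists_isSteinFunction {K : ℝ} (hK : 0 < K) {φ : ℝ → ℝ} (hφ : Continuous φ)
    (hb : ∀ x, |φ x| ≤ 1) : ∃ (g : ℝ → ℝ) (c : ℝ), IsSteinFunction K g ∧
      ∀ w, K * deriv g w - w * g w = (∫ t in (0 : ℝ)..w, φ t) - c := by
  have hs : 0 < √K := Real.sqrt_pos.2 hK
  set ψ : ℝ → ℝ := fun x => φ (√K * x)
  have hψ : Continuous ψ := by fun_prop
  have hψb : ∀ x, |ψ x| ≤ 1 := fun x => hb _
  have hg := StdNormal.isSteinFunction_steinSolution hψ hψb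
  obtain ⟨c, hc⟩ := StdNormal.exists_steinEquation hψ hψb
  refine ⟨fun w => StdNormal.steinSolution ψ (w / √K), √K * c, hg.comp_div_sqrt hK, fun w => ?_⟩
  have hscale : √K * ∫ t in (0 : ℝ)..(w / √K), ψ t = ∫ t in (0 : ℝ)..w, φ t := by
    rw [intervalIntegral.mul_integral_comp_mul_left, mul_zero, mul_div_cancel₀ _ hs.ne']
  rw [deriv_comp_div_const, ← hscale, ← mul_sub, ← hc]
  nth_rw 1 [← Real.mul_self_sqrt hK.le]
  field_simp

theorem wassersteinOne_map_le {Ω : Type*} [MeasurableSpace Ω] {P : Measure Ω} {X Y : Ω → ℝ}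
    (hX : AEMeasurable X P) (hY : AEMeasurable Y P) :
    wassersteinOne (P.map X) (P.map Y) ≤ ∫⁻ ω, edist (X ω) (Y ω) ∂P := by
  refine (iInf_le _ (P.map fun ω => (X ω, Y ω))).trans ?_
  refine (iInf₂_le (Measure.fst_map_prodMk₀ hY) (Measure.snd_map_prodMk₀ hX)).trans ?_
  rw [lintegral_map' (by fun_prop) (hX.prodMk hY)]

/-- The quantile function of a law on the real line. It is meaningful on the open unit interval
only: elsewhere the infimum may be taken over an empty or an unbounded set. -/
noncomputable def quantile (μ : Measure ℝ) (u : ℝ) : ℝ := sInf {t | u ≤ cdf μ t}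

section Quantile

variable (μ : Measure ℝ)

theorem quantile_le_iff {u : ℝ} (hu : u ∈ Ioo (0 : ℝ) 1) (t : ℝ) :
    quantile μ u ≤ t ↔ u ≤ cdf μ t := by
  have hbdd : BddBelow {t | u ≤ cdf μ t} := by
    obtain ⟨s, hs⟩ := ((tendsto_cdf_atBot μ).eventually_lt_const hu.1).exists
    refine ⟨s, fun t ht => ?_⟩
    by_contra! hlt
    exact absurd (monotone_cdf μ hlt.le) (not_le.2 (hs.trans_le ht))
  have hne : {t | u ≤ cdf μ t}.Nonempty := by
    obtain ⟨s, hs⟩ := ((tendsto_cdf_atTop μ).eventually_const_lt hu.2).exists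
    exact ⟨s, hs.le⟩
  refine ⟨fun h => ?_, fun h => csInf_le hbdd h⟩
  have hright : Tendsto (cdf μ) (𝓝[>] t) (𝓝 (cdf μ t)) :=
    ((cdf μ).right_continuous t).mono_left (nhdsWithin_mono t Ioi_subset_Ici_self)
  refine ge_of_tendsto hright ?_
  filter_upwards [self_mem_nhdsWithin] with s hs
  obtain ⟨r, hr, hrs⟩ := exists_lt_of_csInf_lt hne (h.trans_lt hs)
  exact le_trans hr (monotone_cdf μ hrs.le)

theorem monotoneOn_quantile : MonotoneOn (quantile μ) (Ioo 0 1) := by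
  intro u hu v hv huv
  rw [quantile_le_iff μ hu]
  exact huv.trans ((quantile_le_iff μ hv _).1 le_rfl)

theorem aemeasurable_quantile : AEMeasurable (quantile μ) (volume.restrict (Ioo 0 1)) :=
  aemeasurable_restrict_of_monotoneOn measurableSet_Ioo (monotoneOn_quantile μ)

theorem map_quantile [IsProbabilityMeasure μ] :
    (volume.restrict (Ioo 0 1)).map (quantile μ) = μ := by
  have : IsFiniteMeasure ((volume.restrict (Ioo (0 : ℝ) 1)).map (quantile μ)) := inferInstance
  refine Measure.ext_of_Iic _ _ fun t => ?_
  have hset : {u | quantile μ u ≤ t} =ᵐ[volume.restrict (Ioo 0 1)] Iic (cdf μ t) := by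
    filter_upwards [ae_restrict_mem measurableSet_Ioo] with u hu
    exact propext (quantile_le_iff μ hu t)
  have hinter : (Iic (cdf μ t) ∩ Ioo 0 1 : Set ℝ) =ᵐ[volume] Ioc 0 (cdf μ t) := by
    have : (Iic (cdf μ t) ∩ Ioc 0 1 : Set ℝ) = Ioc 0 (cdf μ t) := by
      rw [inter_comm, Ioc_inter_Iic, min_eq_right (cdf_le_one μ t)]
    exact this ▸ (ae_eq_refl _).inter Ioo_ae_eq_Ioc
  rw [Measure.map_apply_of_aemeasurable (aemeasurable_quantile μ) measurableSet_Iic,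
    ← ofReal_cdf μ t]
  change volume.restrict (Ioo 0 1) {u | quantile μ u ≤ t} = _
  rw [measure_congr hset, Measure.restrict_apply measurableSet_Iic, measure_congr hinter,
    Real.volume_Ioc, sub_zero]

end Quantile

/-- The difference of the unit steps at `b` and at `a`. It is the kernel of the representation
`φ a - φ b = ∫ φ' t * stepDiff a b t` that turns a coupling of two laws into the difference of
their distribution functions. -/
noncomputable def stepDiff (a b t : ℝ) : ℝ := (Ici b).indicator 1 t - (Ici a).indicator 1 t

theorem stepDiff_comm (a b t : ℝ) : stepDiff a b t = -stepDiff b a t := (neg_sub _ _).symm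

theorem stepDiff_of_le {a b : ℝ} (h : b ≤ a) : stepDiff a b = (Ico b a).indicator 1 := by
  ext t
  rw [stepDiff, ← Ici_sdiff_Ici, indicator_sdiff (Ici_subset_Ici.2 h)]
  rfl

theorem integral_mul_stepDiff (φ : ℝ → ℝ) (a b : ℝ) :
    ∫ t, φ t * stepDiff a b t = ∫ t in b..a, φ t := by
  have key : ∀ {a b : ℝ}, b ≤ a → ∫ t, φ t * stepDiff a b t = ∫ t in b..a, φ t := by
    intro a b h
    simp_rw [stepDiff_of_le h, ← indicator_mul_right _ φ, Pi.one_apply, mul_one]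
    rw [integral_indicator measurableSet_Ico, intervalIntegral.integral_of_le h,
      integral_Ico_eq_integral_Ioc]
  rcases le_total b a with h | h
  · exact key h
  · simp_rw [stepDiff_comm a b, mul_neg]
    rw [integral_neg, key h, intervalIntegral.integral_symm, neg_neg]

theorem integrable_stepDiff (a b : ℝ) : Integrable (stepDiff a b) := by
  have key : ∀ {a b : ℝ}, b ≤ a → Integrable (stepDiff a b) := fun h => by
    rw [stepDiff_of_le h, integrable_indicator_iff measurableSet_Ico]
    exact integrableOn_const (by simp)
  rcases le_total b a with h | h
  · exact key h
  · exact (key h).neg.congr (ae_of_all _ fun t => (stepDiff_comm a b t).symm)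

theorem integral_abs_stepDiff (a b : ℝ) : ∫ t, |stepDiff a b t| = |a - b| := by
  have key : ∀ {a b : ℝ}, b ≤ a → ∫ t, |stepDiff a b t| = |a - b| := by
    intro a b h
    have habs : ∀ t, |stepDiff a b t| = 1 * stepDiff a b t := fun t => by
      rw [one_mul, stepDiff_of_le h, abs_of_nonneg (indicator_nonneg (by simp) t)]
    simp_rw [habs]
    rw [integral_mul_stepDiff fun _ => 1, intervalIntegral.integral_const, smul_eq_mul, mul_one,
      abs_of_nonneg (sub_nonneg.2 h)]
  rcases le_total b a with h | h
  · exact key h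
  · simp_rw [stepDiff_comm a b, abs_neg]
    rw [key h, abs_sub_comm]

section Coupling

variable {Ω : Type*} [MeasurableSpace Ω] {P : Measure Ω} {X Y : Ω → ℝ}

theorem integrable_stepDiff_prod (hX : Integrable X P) (hY : Integrable Y P) :
    Integrable (fun p : Ω × ℝ => stepDiff (X p.1) (Y p.1) p.2) (P.prod volume) := by
  have hmeas : Measurable fun q : (ℝ × ℝ) × ℝ => stepDiff q.1.1 q.1.2 q.2 := by
    refine (Measurable.indicator (measurable_const (a := (1 : ℝ))) ?_).sub
      (Measurable.indicator (measurable_const (a := (1 : ℝ))) ?_)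
    · exact measurableSet_le (by fun_prop) measurable_snd
    · exact measurableSet_le (by fun_prop) measurable_snd
  have hae : AEStronglyMeasurable (fun p : Ω × ℝ => stepDiff (X p.1) (Y p.1) p.2)
      (P.prod volume) :=
    (hmeas.comp_aemeasurable (((hX.aemeasurable.comp_fst).prodMk hY.aemeasurable.comp_fst).prodMk
      measurable_snd.aemeasurable)).aestronglyMeasurable
  refine (integrable_prod_iff hae).2 ⟨ae_of_all _ fun ω => integrable_stepDiff (X ω) (Y ω), ?_⟩
  simp_rw [Real.norm_eq_abs, integral_abs_stepDiff]
  exact (hX.sub hY).abs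

theorem continuous_primitive {φ : ℝ → ℝ} (hφ : Continuous φ) :
    Continuous fun x => ∫ t in (0:ℝ)..x, φ t :=
  intervalIntegral.continuous_primitive (fun a b => hφ.intervalIntegrable a b) 0

theorem integrable_primitive (hX : Integrable X P) {φ : ℝ → ℝ} (hφ : Continuous φ)
    (hb : ∀ x, |φ x| ≤ 1) : Integrable (fun ω => ∫ t in (0:ℝ)..X ω, φ t) P := by
  refine hX.mono ((continuous_primitive hφ).comp_aestronglyMeasurable hX.aestronglyMeasurable)
    (ae_of_all _ fun ω => ?_)
  simpa using intervalIntegral.norm_integral_le_of_norm_le_const (f := φ) (a := 0) (b := X ω)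
    (fun t _ => hb t)

theorem integral_primitive_sub_primitive [SFinite P] (hX : Integrable X P)
    (hY : Integrable Y P) {φ : ℝ → ℝ} (hφ : Continuous φ) (hb : ∀ x, |φ x| ≤ 1) :
    ∫ ω, ((∫ t in (0:ℝ)..X ω, φ t) - ∫ t in (0:ℝ)..Y ω, φ t) ∂P =
      ∫ t, φ t * ∫ ω, stepDiff (X ω) (Y ω) t ∂P := by
  have hint : Integrable (fun p : Ω × ℝ => φ p.2 * stepDiff (X p.1) (Y p.1) p.2)
      (P.prod volume) :=
    (integrable_stepDiff_prod hX hY).bdd_mul (c := 1) (by fun_prop) (ae_of_all _ fun p => hb _)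
  have hprim : ∀ a b : ℝ, (∫ t in (0:ℝ)..a, φ t) - ∫ t in (0:ℝ)..b, φ t =
      ∫ t, φ t * stepDiff a b t := fun a b => by
    rw [integral_mul_stepDiff, intervalIntegral.integral_interval_sub_left
      (hφ.intervalIntegrable _ _) (hφ.intervalIntegrable _ _)]
  simp_rw [hprim]
  rw [integral_integral_swap hint]
  simp_rw [integral_const_mul]

end Coupling

theorem integral_abs_stepDiff_quantile (μ ν : Measure ℝ) (t : ℝ) :
    ∫ u in Ioo 0 1, |stepDiff (quantile μ u) (quantile ν u) t| =
      |∫ u in Ioo 0 1, stepDiff (quantile μ u) (quantile ν u) t| := by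
  have key : ∀ {μ ν : Measure ℝ}, cdf μ t ≤ cdf ν t → ∀ᵐ u ∂volume.restrict (Ioo (0 : ℝ) 1),
      0 ≤ stepDiff (quantile μ u) (quantile ν u) t := by
    intro μ ν h
    filter_upwards [ae_restrict_mem measurableSet_Ioo] with u hu
    by_cases hq : quantile μ u ≤ t
    · have : quantile ν u ≤ t :=
        (quantile_le_iff ν hu t).2 (((quantile_le_iff μ hu t).1 hq).trans h)
      simp [stepDiff, hq, this]
    · simp [stepDiff, hq, indicator_nonneg]
  rcases le_total (cdf μ t) (cdf ν t) with h | h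
  · rw [abs_of_nonneg (integral_nonneg_of_ae (key h))]
    exact integral_congr_ae ((key h).mono fun u hu => abs_of_nonneg hu)
  · simp_rw [stepDiff_comm (quantile μ _), abs_neg, integral_neg, abs_neg]
    rw [abs_of_nonneg (integral_nonneg_of_ae (key h))]
    exact integral_congr_ae ((key h).mono fun u hu => abs_of_nonneg hu)

theorem tendsto_integral_sq_div_abs_add {h : ℝ → ℝ} (hi : Integrable h) :
    Tendsto (fun δ : ℝ => ∫ t, h t / (|h t| + δ) * h t) (𝓝[>] 0) (𝓝 (∫ t, |h t|)) := by
  refine tendsto_integral_filter_of_dominated_convergence (fun t => |h t|) ?_ ?_ hi.abs ?_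
  · filter_upwards with δ
    have := hi.aemeasurable
    exact AEMeasurable.aestronglyMeasurable (by fun_prop)
  · filter_upwards [self_mem_nhdsWithin] with δ (hδ : 0 < δ)
    refine ae_of_all _ fun t => ?_
    rw [norm_mul, Real.norm_eq_abs, Real.norm_eq_abs, abs_div, abs_of_pos (a := |h t| + δ)
      (by positivity)]
    exact mul_le_of_le_one_left (abs_nonneg _) ((div_le_one (by positivity)).2 (by linarith))
  · refine ae_of_all _ fun t => ?_
    rcases eq_or_ne (h t) 0 with h0 | h0
    · simp [h0]
    have hcont : ContinuousAt (fun δ : ℝ => h t / (|h t| + δ) * h t) 0 :=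
      ContinuousAt.mul (continuousAt_const.div (by fun_prop) (by simpa using h0)) (by fun_prop)
    have hval : h t / (|h t| + 0) * h t = |h t| := by
      rw [add_zero, div_mul_eq_mul_div, ← abs_mul_abs_self, mul_self_div_self]
    have hlim := hcont.tendsto.mono_left (nhdsWithin_le_nhds (s := Ioi 0))
    rwa [hval] at hlim

theorem integral_abs_le_of_forall_continuous {κ : ℝ → ℝ} (hκ : Integrable κ) {C : ℝ}
    (hC : ∀ φ : ℝ → ℝ, Continuous φ → (∀ x, |φ x| ≤ 1) → ∫ t, φ t * κ t ≤ C) :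
    ∫ t, |κ t| ≤ C := by
  refine le_of_forall_pos_le_add fun ε hε => ?_
  obtain ⟨h, hκh, hi⟩ := hκ.exists_boundedContinuous_integral_sub_le (half_pos hε)
  have hdiff : Integrable fun t => |κ t - h t| := (hκ.sub hi).abs
  have hle : ∀ᶠ δ in 𝓝[>] (0 : ℝ), ∫ t, h t / (|h t| + δ) * h t ≤ C + ε / 2 := by
    filter_upwards [self_mem_nhdsWithin] with δ (hδ : 0 < δ)
    have hpos : ∀ t, 0 < |h t| + δ := fun t => by positivity
    have hφ : Continuous fun t => h t / (|h t| + δ) :=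
      h.continuous.div (by fun_prop) fun t => (hpos t).ne'
    have hb : ∀ t, |h t / (|h t| + δ)| ≤ 1 := fun t => by
      rw [abs_div, abs_of_pos (hpos t), div_le_one (hpos t)]
      linarith
    have hmul : ∀ {f : ℝ → ℝ}, Integrable f → Integrable fun t => h t / (|h t| + δ) * f t :=
      fun hf => hf.bdd_mul (c := 1) hφ.aestronglyMeasurable (ae_of_all _ hb)
    calc ∫ t, h t / (|h t| + δ) * h t
        ≤ ∫ t, (h t / (|h t| + δ) * κ t + |κ t - h t|) := by
          refine integral_mono (hmul hi) ((hmul hκ).add hdiff) fun t => ?_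
          have := (neg_le_abs _).trans ((abs_mul (h t / (|h t| + δ)) (κ t - h t)).trans_le
            (mul_le_of_le_one_left (abs_nonneg _) (hb t)))
          linear_combination this
      _ ≤ C + ε / 2 := by
          rw [integral_add (hmul hκ) hdiff]
          exact add_le_add (hC _ hφ hb) hκh
  calc ∫ t, |κ t| ≤ ∫ t, (|κ t - h t| + |h t|) :=
        integral_mono hκ.abs (hdiff.add hi.abs) fun t => by
          simpa using abs_add_le (κ t - h t) (h t)
    _ = (∫ t, |κ t - h t|) + ∫ t, |h t| := integral_add hdiff hi.abs
    _ ≤ ε / 2 + (C + ε / 2) :=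
        add_le_add hκh (le_of_tendsto (tendsto_integral_sq_div_abs_add hi) hle)
    _ = C + ε := by ring

theorem wassersteinOne_le_of_forall_integral {μ ν : Measure ℝ} [IsProbabilityMeasure μ]
    [IsProbabilityMeasure ν] (hμ : Integrable id μ) (hν : Integrable id ν) {C : ℝ}
    (h : ∀ φ : ℝ → ℝ, Continuous φ → (∀ x, |φ x| ≤ 1) →
      (∫ x, (∫ t in (0:ℝ)..x, φ t) ∂μ) - ∫ x, (∫ t in (0:ℝ)..x, φ t) ∂ν ≤ C) :
    wassersteinOne μ ν ≤ ENNReal.ofReal C := by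
  rw [← map_quantile μ] at hμ h
  rw [← map_quantile ν] at hν h
  have hX : IntegrableOn (quantile μ) (Ioo 0 1) :=
    hμ.comp_aemeasurable (aemeasurable_quantile μ)
  have hY : IntegrableOn (quantile ν) (Ioo 0 1) :=
    hν.comp_aemeasurable (aemeasurable_quantile ν)
  have htest : ∀ φ : ℝ → ℝ, Continuous φ → (∀ x, |φ x| ≤ 1) →
      ∫ t, φ t * ∫ u in Ioo 0 1, stepDiff (quantile μ u) (quantile ν u) t ≤ C := by
    intro φ hφ hb
    have key := h φ hφ hb
    rwa [integral_map (aemeasurable_quantile μ) (continuous_primitive hφ).aestronglyMeasurable,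
      integral_map (aemeasurable_quantile ν) (continuous_primitive hφ).aestronglyMeasurable,
      ← integral_sub (integrable_primitive hX hφ hb) (integrable_primitive hY hφ hb),
      integral_primitive_sub_primitive hX hY hφ hb] at key
  have hprod := integrable_stepDiff_prod hX hY
  have hcost : ∫ u in Ioo 0 1, |quantile μ u - quantile ν u| ≤ C :=
    calc ∫ u in Ioo 0 1, |quantile μ u - quantile ν u|
        = ∫ u in Ioo 0 1, ∫ t, |stepDiff (quantile μ u) (quantile ν u) t| := by
          simp_rw [integral_abs_stepDiff]
      _ = ∫ t, ∫ u in Ioo 0 1, |stepDiff (quantile μ u) (quantile ν u) t| :=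
          integral_integral_swap hprod.abs
      _ = ∫ t, |∫ u in Ioo 0 1, stepDiff (quantile μ u) (quantile ν u) t| := by
          simp_rw [integral_abs_stepDiff_quantile]
      _ ≤ C := integral_abs_le_of_forall_continuous hprod.integral_prod_right htest
  calc wassersteinOne μ ν
      ≤ ∫⁻ u in Ioo 0 1, edist (quantile μ u) (quantile ν u) := by
        simpa only [map_quantile] using
          wassersteinOne_map_le (aemeasurable_quantile μ) (aemeasurable_quantile ν)
    _ = ENNReal.ofReal (∫ u in Ioo 0 1, |quantile μ u - quantile ν u|) := by
        simp_rw [edist_dist, Real.dist_eq]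
        exact (ofReal_integral_eq_lintegral_ofReal (hX.sub hY).abs
          (ae_of_all _ fun u => abs_nonneg _)).symm
    _ ≤ ENNReal.ofReal C := ENNReal.ofReal_le_ofReal hcost

theorem integrable_id_gaussianReal (m : ℝ) (v : ℝ≥0) : Integrable id (gaussianReal m v) :=
  memLp_one_iff_integrable.1 (memLp_id_gaussianReal 1)

theorem integrable_gaussianReal_iff {m : ℝ} {v : ℝ≥0} (hv : v ≠ 0) {h : ℝ → ℝ} :
    Integrable h (gaussianReal m v) ↔ Integrable fun x => h x * gaussianPDFReal m v x := by
  rw [gaussianReal_of_var_ne_zero m hv, integrable_withDensity_iff_integrable_smul'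
    (measurable_gaussianPDF m v) (ae_of_all _ fun _ => gaussianPDF_lt_top)]
  simp_rw [toReal_gaussianPDF, smul_eq_mul, mul_comm]

theorem integral_gaussianReal_mul_eq_integral_deriv {m : ℝ} {v : ℝ≥0} {g : ℝ → ℝ}
    (hg : Differentiable ℝ g) (hgi : Integrable g (gaussianReal m v))
    (hdg : Integrable (deriv g) (gaussianReal m v))
    (hmg : Integrable (fun x => (x - m) * g x) (gaussianReal m v)) :
    ∫ x, (x - m) * g x ∂gaussianReal m v = v * ∫ x, deriv g x ∂gaussianReal m v := by
  rcases eq_or_ne v 0 with rfl | hv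
  · simp
  have hv' : (v : ℝ) ≠ 0 := by exact_mod_cast hv
  rw [integrable_gaussianReal_iff hv] at hgi hdg hmg
  have hscale : ∀ x, (x - m) * g x * gaussianPDFReal m v x =
      -v * (g x * -((x - m) / v * gaussianPDFReal m v x)) := fun x => by field_simp
  have hmg' : Integrable fun x => g x * -((x - m) / v * gaussianPDFReal m v x) := by
    simp_rw [hscale] at hmg
    exact (integrable_const_mul_iff (isUnit_iff_ne_zero.2 (neg_ne_zero.2 hv')) _).1 hmg
  rw [integral_gaussianReal_eq_integral_smul hv, integral_gaussianReal_eq_integral_smul hv]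
  simp_rw [smul_eq_mul, mul_comm (gaussianPDFReal m v _), hscale]
  rw [integral_const_mul, integral_mul_deriv_eq_deriv_mul_of_integrable
    (fun x _ => (hg x).hasDerivAt) (fun x _ => hasDerivAt_gaussianPDFReal m hv x) hmg' hdg hgi,
    neg_mul_neg]

section SteinMethod

variable {Ω : Type*} [MeasurableSpace Ω] {P : Measure Ω} {K : ℝ} {g : ℝ → ℝ}

namespace IsSteinFunction

theorem integrable_mul_comp (hg : IsSteinFunction K g) {Z V : Ω → ℝ} (hZ : Integrable Z P)
    (hV : AEMeasurable V P) : Integrable (fun ω => Z ω * g (V ω)) P :=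
  hZ.mul_bdd (c := 1) (hg.continuous.measurable.comp_aemeasurable hV).aestronglyMeasurable
    (ae_of_all _ fun ω => hg.abs_le_one (V ω))

theorem integrable_mul_deriv_comp (hg : IsSteinFunction K g) {Z V : Ω → ℝ} (hZ : Integrable Z P)
    (hV : AEMeasurable V P) : Integrable (fun ω => Z ω * deriv g (V ω)) P :=
  hZ.mul_bdd (c := √(2 / (K * Real.pi)))
    (hg.continuous_deriv.measurable.comp_aemeasurable hV).aestronglyMeasurable
    (ae_of_all _ fun ω => hg.abs_deriv_le (V ω))

theorem integral_id_mul_comp_add_gaussianReal (hg : IsSteinFunction K g) (v : ℝ≥0) (y : ℝ) :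
    ∫ x, x * g (x + y) ∂gaussianReal 0 v = v * ∫ x, deriv g (x + y) ∂gaussianReal 0 v := by
  have hV : AEMeasurable (fun x : ℝ => x + y) (gaussianReal 0 v) := by fun_prop
  have hone : Integrable (fun _ => (1 : ℝ)) (gaussianReal 0 v) := integrable_const 1
  have hmul := hg.integrable_mul_comp (integrable_id_gaussianReal 0 v) hV
  have hderiv : deriv (fun x => g (x + y)) = fun x => deriv g (x + y) :=
    funext fun x => deriv_comp_add_const g y x
  have h := integral_gaussianReal_mul_eq_integral_deriv (m := 0) (v := v)
    (g := fun x => g (x + y)) (hg.differentiable.comp (differentiable_id.add_const y))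
    (by simpa using hg.integrable_mul_comp hone hV)
    (by simpa [hderiv] using hg.integrable_mul_deriv_comp hone hV)
    (by simpa using hmul)
  simpa [hderiv] using h

theorem integral_steinOperator_gaussianReal (hg : IsSteinFunction K g) (hK : 0 ≤ K) :
    ∫ x, (K * deriv g x - x * g x) ∂gaussianReal 0 K.toNNReal = 0 := by
  have h := hg.integral_id_mul_comp_add_gaussianReal K.toNNReal 0
  simp_rw [add_zero, Real.coe_toNNReal _ hK] at h
  have hd := hg.integrable_mul_deriv_comp (integrable_const K)
    (aemeasurable_id' (μ := gaussianReal 0 K.toNNReal))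
  have hm := hg.integrable_mul_comp (integrable_id_gaussianReal 0 K.toNNReal) aemeasurable_id'
  simp only [id_eq] at hm
  rw [integral_sub hd hm, h, integral_const_mul, sub_self]

theorem integral_gaussian_mul_comp_add [IsProbabilityMeasure P] (hg : IsSteinFunction K g)
    {v : ℝ≥0} {b F : Ω → ℝ} (hlaw : P.map b = gaussianReal 0 v) (hF : AEMeasurable F P)
    (hind : IndepFun b F P) :
    ∫ ω, b ω * g (b ω + F ω) ∂P = v * ∫ ω, deriv g (b ω + F ω) ∂P := by
  have hb : AEMeasurable b P := aemeasurable_of_map_neZero (by rw [hlaw]; infer_instance)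
  have := Measure.isProbabilityMeasure_map hF
  have hpair := (indepFun_iff_map_prod_eq_prod_map_map hb hF).1 hind
  rw [hlaw] at hpair
  have hgc := hg.continuous
  have hdgc := hg.continuous_deriv
  have hfubini : ∀ {H : ℝ × ℝ → ℝ}, Continuous H →
      Integrable H ((gaussianReal 0 v).prod (P.map F)) →
      ∫ ω, H (b ω, F ω) ∂P = ∫ y, ∫ x, H (x, y) ∂gaussianReal 0 v ∂(P.map F) := by
    intro H hH hi
    rw [← integral_prod_symm H hi, ← hpair,
      integral_map (hb.prodMk hF) hH.aestronglyMeasurable]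
  rw [hfubini (H := fun p => p.1 * g (p.1 + p.2)) (by fun_prop)
      (hg.integrable_mul_comp ((integrable_id_gaussianReal 0 v).comp_fst _) (by fun_prop)),
    hfubini (H := fun p => deriv g (p.1 + p.2)) (by fun_prop)
      (by simpa using hg.integrable_mul_deriv_comp (integrable_const (1 : ℝ)) (by fun_prop)),
    ← integral_const_mul]
  simp_rw [hg.integral_id_mul_comp_add_gaussianReal v]

end IsSteinFunction

theorem wassersteinOne_gaussianReal_le [IsProbabilityMeasure P] {V : Ω → ℝ} (hV : Integrable V P)
    {C : ℝ} (hK : 0 < K)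
    (h : ∀ g, IsSteinFunction K g → ∫ ω, (K * deriv g (V ω) - V ω * g (V ω)) ∂P ≤ C) :
    wassersteinOne (P.map V) (gaussianReal 0 K.toNNReal) ≤ ENNReal.ofReal C := by
  have := Measure.isProbabilityMeasure_map hV.aemeasurable
  have hid : Integrable id (P.map V) := (integrable_map_measure (by fun_prop) hV.aemeasurable).2 hV
  refine wassersteinOne_le_of_forall_integral hid (integrable_id_gaussianReal 0 _) ?_
  intro φ hφ hb
  obtain ⟨g, c, hg, heq⟩ := exists_isSteinFunction hK hφ hb
  have hsplit : ∀ μ : Measure ℝ, IsProbabilityMeasure μ → Integrable id μ →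
      ∫ x, (∫ t in (0:ℝ)..x, φ t) ∂μ = ∫ x, (K * deriv g x - x * g x) ∂μ + c := by
    intro μ _ hμ
    have hi : Integrable (fun x => K * deriv g x - x * g x) μ :=
      (hg.integrable_mul_deriv_comp (integrable_const K) aemeasurable_id).sub
        (hg.integrable_mul_comp hμ aemeasurable_id)
    simp_rw [fun x => (sub_eq_iff_eq_add.1 (heq x).symm)]
    rw [integral_add hi (integrable_const c), integral_const, probReal_univ, one_smul]
  have hgc := hg.continuous
  have hdgc := hg.continuous_deriv
  rw [hsplit _ inferInstance hid, hsplit _ inferInstance (integrable_id_gaussianReal 0 _),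
    hg.integral_steinOperator_gaussianReal hK.le, zero_add, add_sub_cancel_right,
    integral_map hV.aemeasurable (by fun_prop)]
  exact h g hg

theorem wassersteinOne_gaussian_add_le [IsProbabilityMeasure P] {v : ℝ≥0} {b F : Ω → ℝ}
    (hlaw : P.map b = gaussianReal 0 v) (hF : Integrable F P) (hind : IndepFun b F P) {C : ℝ}
    (hK : 0 < K)
    (h : ∀ g, IsSteinFunction K g →
      ∫ ω, ((K - v) * deriv g (b ω + F ω) - F ω * g (b ω + F ω)) ∂P ≤ C) :
    wassersteinOne (P.map fun ω => b ω + F ω) (gaussianReal 0 K.toNNReal) ≤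
      ENNReal.ofReal C := by
  have hbm : AEMeasurable b P := aemeasurable_of_map_neZero (by rw [hlaw]; infer_instance)
  have hb : Integrable b P := (integrable_map_measure (g := id) (by fun_prop) hbm).1
    (hlaw ▸ integrable_id_gaussianReal 0 v)
  have hV : AEMeasurable (fun ω => b ω + F ω) P := hbm.add hF.aemeasurable
  refine wassersteinOne_gaussianReal_le (hb.add hF) hK fun g hg => (h g hg).trans' (le_of_eq ?_)
  have hd : ∀ c : ℝ, Integrable (fun ω => c * deriv g (b ω + F ω)) P := fun c =>
    hg.integrable_mul_deriv_comp (integrable_const c) hV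
  have hbg := hg.integrable_mul_comp hb hV
  have hmain : Integrable (fun ω => (K - v) * deriv g (b ω + F ω) - F ω * g (b ω + F ω)) P :=
    (hd _).sub (hg.integrable_mul_comp hF hV)
  have hrest : Integrable (fun ω => v * deriv g (b ω + F ω) - b ω * g (b ω + F ω)) P :=
    (hd _).sub hbg
  calc ∫ ω, (K * deriv g (b ω + F ω) - (b ω + F ω) * g (b ω + F ω)) ∂P
      = ∫ ω, (((K - v) * deriv g (b ω + F ω) - F ω * g (b ω + F ω)) +
          (v * deriv g (b ω + F ω) - b ω * g (b ω + F ω))) ∂P := by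
        congr with ω
        ring
    _ = _ := by
        rw [integral_add hmain hrest, integral_sub (hd _) hbg,
          hg.integral_gaussian_mul_comp_add hlaw hF.aemeasurable hind, integral_const_mul,
          sub_self, add_zero]

end SteinMethod

section SubsetWeight

variable {ι : Type*} [Fintype ι]

/-- The weights with which the statistic `T` averages over the subsets of the index set; `j ∉ A`
being drawn uniformly, they come from a uniform choice of the order in which the coordinates are
resampled. At the full set the weight is `1 / 0 = 0`. -/
noncomputable def subsetWeight (A : Finset ι) : ℝ :=
  1 / ((Fintype.card ι).choose A.card * (Fintype.card ι - A.card))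

theorem subsetWeight_nonneg (A : Finset ι) : 0 ≤ subsetWeight A := by
  have : (A.card : ℝ) ≤ Fintype.card ι := by exact_mod_cast A.card_le_univ
  exact one_div_nonneg.2 (mul_nonneg (Nat.cast_nonneg _) (sub_nonneg.2 this))

variable [DecidableEq ι]

theorem card_compl_mul_subsetWeight (A : Finset ι) :
    Aᶜ.card * subsetWeight A =
      ((Fintype.card ι).choose A.card : ℝ)⁻¹ - if A = Finset.univ then 1 else 0 := by
  split_ifs with hA
  · simp [hA]
  have hlt : A.card < Fintype.card ι := Finset.card_lt_univ_of_notMem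
    (not_forall.1 fun h => hA (Finset.eq_univ_iff_forall.2 h)).choose_spec
  have hne : (Fintype.card ι : ℝ) - A.card ≠ 0 := sub_ne_zero.2 (by exact_mod_cast hlt.ne')
  rw [Finset.card_compl, Nat.cast_sub hlt.le, subsetWeight, sub_zero]
  field_simp

theorem sum_subsetWeight_erase (B : Finset ι) :
    ∑ j ∈ B, subsetWeight (B.erase j) =
      ((Fintype.card ι).choose B.card : ℝ)⁻¹ - if B = ∅ then 1 else 0 := by
  split_ifs with hB
  · simp [hB]
  obtain ⟨m, hm⟩ : ∃ m, B.card = m + 1 :=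
    Nat.exists_eq_succ_of_ne_zero (Finset.card_ne_zero.2 (Finset.nonempty_iff_ne_empty.2 hB))
  have hle : m + 1 ≤ Fintype.card ι := hm ▸ B.card_le_univ
  have hchoose : ((Fintype.card ι).choose m : ℝ) * (Fintype.card ι - m) =
      (Fintype.card ι).choose (m + 1) * (m + 1) := by
    rw [← Nat.cast_sub (by lia)]
    exact_mod_cast (Nat.choose_succ_right_eq (Fintype.card ι) m).symm
  have hterm : ∀ j ∈ B, subsetWeight (B.erase j) =
      1 / ((Fintype.card ι).choose (m + 1) * (m + 1)) := fun j hj => by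
    rw [subsetWeight, Finset.card_erase_of_mem hj, hm, Nat.add_sub_cancel, hchoose]
  have hpos : ((Fintype.card ι).choose (m + 1) : ℝ) ≠ 0 := by
    exact_mod_cast (Nat.choose_pos hle).ne'
  rw [Finset.sum_congr rfl hterm, Finset.sum_const, hm, nsmul_eq_mul, sub_zero]
  push_cast
  field_simp

theorem sum_sum_compl_eq_sum_sum_erase {M : Type*} [AddCommMonoid M] (F : Finset ι → ι → M) :
    ∑ A, ∑ j ∈ Aᶜ, F A j = ∑ B, ∑ j ∈ B, F (B.erase j) j := by
  rw [Finset.sum_sigma', Finset.sum_sigma']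
  refine Finset.sum_bij' (fun p _ => ⟨insert p.2 p.1, p.2⟩) (fun p _ => ⟨p.1.erase p.2, p.2⟩)
    ?_ ?_ ?_ ?_ ?_ <;>
  simp +contextual

theorem sum_subsetWeight_mul_sum_sub (u : Finset ι → ℝ) :
    ∑ A, subsetWeight A * ∑ j ∈ Aᶜ, (u A - u (insert j A)) = u ∅ - u Finset.univ := by
  have hself : ∀ A : Finset ι, subsetWeight A * ∑ _j ∈ Aᶜ, u A =
      (((Fintype.card ι).choose A.card : ℝ)⁻¹ - if A = Finset.univ then 1 else 0) * u A :=
    fun A => by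
      rw [← card_compl_mul_subsetWeight, Finset.sum_const, nsmul_eq_mul]
      ring
  have hinsert : ∑ A : Finset ι, subsetWeight A * ∑ j ∈ Aᶜ, u (insert j A) =
      ∑ B : Finset ι, (((Fintype.card ι).choose B.card : ℝ)⁻¹ - if B = ∅ then 1 else 0) * u B := by
    simp_rw [Finset.mul_sum]
    rw [sum_sum_compl_eq_sum_sum_erase]
    refine Finset.sum_congr rfl fun B _ => ?_
    rw [← sum_subsetWeight_erase, Finset.sum_mul]
    exact Finset.sum_congr rfl fun j hj => by rw [Finset.insert_erase hj]
  simp_rw [Finset.sum_sub_distrib, mul_sub, Finset.sum_sub_distrib, hself, hinsert, sub_mul,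
    Finset.sum_sub_distrib, ite_mul, one_mul, zero_mul, Finset.sum_ite_eq', Finset.mem_univ,
    if_true]
  ring

theorem sum_subsetWeight_mul_sum_compl (d : ι → ℝ) :
    ∑ A, subsetWeight A * ∑ j ∈ Aᶜ, d j = ∑ j, d j := by
  have h := sum_subsetWeight_mul_sum_sub (fun A : Finset ι => ∑ i ∈ Aᶜ, d i)
  simp only [Finset.compl_empty, Finset.compl_univ, Finset.sum_empty, sub_zero] at h
  rw [← h]
  refine Finset.sum_congr rfl fun A _ => congrArg (subsetWeight A * ·) ?_
  refine Finset.sum_congr rfl fun j hj => ?_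
  rw [Finset.compl_insert, eq_sub_iff_add_eq, Finset.add_sum_erase _ _ hj]

theorem sum_subsetWeight_mul_sum_compl_le {F G : Finset ι → ι → ℝ}
    (h : ∀ A, ∀ j ∉ A, F A j ≤ G A j) :
    ∑ A, subsetWeight A * ∑ j ∈ Aᶜ, F A j ≤ ∑ A, subsetWeight A * ∑ j ∈ Aᶜ, G A j :=
  Finset.sum_le_sum fun A _ => mul_le_mul_of_nonneg_left
    (Finset.sum_le_sum fun j hj => h A j (Finset.mem_compl.1 hj)) (subsetWeight_nonneg A)

end SubsetWeight

section IntegrabilityOfPowers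

variable {Ω : Type*} [MeasurableSpace Ω] {P : Measure Ω} {f g : Ω → ℝ}

theorem memLp_four_iff_integrable_pow (hf : AEStronglyMeasurable f P) :
    MemLp f 4 P ↔ Integrable (fun ω => f ω ^ 4) P := by
  rw [← integrable_norm_rpow_iff hf (by norm_num) (by norm_num)]
  simp [Even.pow_abs (n := 4) (by decide), -Nat.cast_ofNat]

theorem memLp_two_mul_of_memLp_four (hf : MemLp f 4 P) (hg : MemLp g 4 P) :
    MemLp (fun ω => f ω * g ω) 2 P := by
  have : ENNReal.HolderTriple 4 4 2 := ⟨by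
    rw [← two_mul, ← ENNReal.toReal_eq_toReal_iff' (by finiteness) (by finiteness)]
    norm_num⟩
  exact hg.mul hf

theorem integrable_abs_pow_three_of_memLp_four [IsFiniteMeasure P] (hf : MemLp f 4 P) :
    Integrable (fun ω => |f ω| ^ 3) P := by
  simpa using (hf.mono_exponent (p := 3) (by norm_num)).integrable_norm_pow (p := 3) (by norm_num)

end IntegrabilityOfPowers

theorem sq_mul_le_of_nonneg {a c : ℝ} (ha : 0 ≤ a) (hc : 0 ≤ c) :
    a ^ 2 * c ≤ (2 * a ^ 3 + c ^ 3) / 3 := by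
  nlinarith [mul_nonneg (add_nonneg (add_nonneg ha ha) hc) (sq_nonneg (a - c))]

theorem IsSteinFunction.mul_mul_deriv_sub_le {K : ℝ} {g : ℝ → ℝ} (hg : IsSteinFunction K g)
    (hK : 0 < K) (y z e : ℝ) :
    (y - z) * e * deriv g y - 1 / K * ((2 * |y - z| ^ 3 + |e| ^ 3) / 3) ≤ e * (g y - g z) := by
  have hbound : |(g y - g z - deriv g y * (y - z)) * e| ≤
      1 / K * ((2 * |y - z| ^ 3 + |e| ^ 3) / 3) :=
    calc |(g y - g z - deriv g y * (y - z)) * e|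
        ≤ 1 / K * (y - z) ^ 2 * |e| := by
          rw [abs_mul]
          gcongr
          exact hg.abs_taylor_le hK y z
      _ = 1 / K * (|y - z| ^ 2 * |e|) := by rw [sq_abs, mul_assoc]
      _ ≤ _ := by
          gcongr
          exact sq_mul_le_of_nonneg (abs_nonneg _) (abs_nonneg _)
  linarith [(abs_le.1 hbound).1]

section Exchange

variable {Ω ι : Type*} [MeasurableSpace Ω] [DecidableEq ι] {P : Measure Ω}

/-- A real family `U` indexed by subsets is exchangeable relative to `b` if the joint law of `b`
and `U` is invariant under `A ↦ A ∆ S` for every set `S`. The example to have in mind is the value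
`U A = f (X^A)` of a statistic after resampling the coordinates in `A`: swapping `X_i` and `X'_i`
for `i ∈ S` turns `X^A` into `X^(A ∆ S)`. -/
def IsExchangeable (P : Measure Ω) (b : Ω → ℝ) (U : Finset ι → Ω → ℝ) : Prop :=
  ∀ S, IdentDistrib (fun ω => (b ω, fun A => U A ω)) (fun ω => (b ω, fun A => U (symmDiff A S) ω))
    P P

theorem symmDiff_insert_self_of_notMem {A : Finset ι} {j : ι} (hj : j ∉ A) :
    symmDiff (insert j A) A = {j} := by
  ext i
  by_cases hi : i = j <;> simp [Finset.mem_symmDiff, hi, hj]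

/-- The statistic `T` in terms of the values `U A` of the function at the resampled vectors. -/
noncomputable def exchangeStat [Fintype ι] (U : Finset ι → Ω → ℝ) (ω : Ω) : ℝ :=
  1 / 2 * ∑ A, subsetWeight A * ∑ j ∈ Aᶜ, (U ∅ ω - U {j} ω) * (U A ω - U (insert j A) ω)

namespace IsExchangeable

variable {b : Ω → ℝ} {U : Finset ι → Ω → ℝ}

theorem integral_eq (h : IsExchangeable P b U) {u : ℝ × (Finset ι → ℝ) → ℝ} (hu : Measurable u)
    (S : Finset ι) :
    ∫ ω, u (b ω, fun A => U A ω) ∂P = ∫ ω, u (b ω, fun A => U (symmDiff A S) ω) ∂P :=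
  ((h S).comp hu).integral_eq

theorem aemeasurable_add (h : IsExchangeable P b U) (A : Finset ι) :
    AEMeasurable (fun ω => b ω + U A ω) P :=
  (show Measurable fun p : ℝ × (Finset ι → ℝ) => p.1 + p.2 A by fun_prop).comp_aemeasurable
    (h ∅).aemeasurable_fst

theorem memLp (h : IsExchangeable P b U) (hL : MemLp (U ∅) 4 P) (A : Finset ι) :
    MemLp (U A) 4 P := by
  have hlaw := (h A).comp (u := fun p : ℝ × (Finset ι → ℝ) => p.2 ∅) (by fun_prop)
  simp only [Function.comp_def, ← Finset.bot_eq_empty, bot_symmDiff] at hlaw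
  exact hlaw.memLp_iff.1 hL

theorem memLp_sub (h : IsExchangeable P b U) (hL : MemLp (U ∅) 4 P) (A B : Finset ι) :
    MemLp (fun ω => U A ω - U B ω) 4 P :=
  (h.memLp hL A).sub (h.memLp hL B)

theorem integral_abs_sub_insert_pow_three (h : IsExchangeable P b U) {A : Finset ι} {j : ι}
    (hj : j ∉ A) :
    ∫ ω, |U A ω - U (insert j A) ω| ^ 3 ∂P = ∫ ω, |U ∅ ω - U {j} ω| ^ 3 ∂P := by
  have hinv := h.integral_eq (u := fun p => |p.2 A - p.2 (insert j A)| ^ 3) (by fun_prop) A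
  simpa only [symmDiff_self, Finset.bot_eq_empty, symmDiff_insert_self_of_notMem hj] using hinv

theorem integral_sub_insert_mul (h : IsExchangeable P b U) {A : Finset ι} {j : ι} (hj : j ∉ A)
    {g : ℝ → ℝ} (hg : Measurable g) :
    ∫ ω, (U A ω - U (insert j A) ω) * g (b ω + U {j} ω) ∂P =
      -∫ ω, (U A ω - U (insert j A) ω) * g (b ω + U ∅ ω) ∂P := by
  have hinv := h.integral_eq (u := fun p => (p.2 A - p.2 (insert j A)) * g (p.1 + p.2 {j}))
    (by fun_prop) {j}
  have hA : symmDiff A {j} = insert j A := by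
    rw [← symmDiff_insert_self_of_notMem hj, symmDiff_comm, symmDiff_symmDiff_cancel_right]
  have hA' : symmDiff (insert j A) {j} = A := by
    rw [← hA, symmDiff_symmDiff_cancel_right]
  simp only [hA, hA', symmDiff_self, Finset.bot_eq_empty] at hinv
  rw [hinv, ← integral_neg]
  congr with ω
  ring

theorem memLp_two_exchangeStat [Fintype ι] (h : IsExchangeable P b U) (hL : MemLp (U ∅) 4 P) :
    MemLp (exchangeStat U) 2 P :=
  (memLp_finsetSum _ fun _ _ => (memLp_finsetSum _ fun _ _ =>
    memLp_two_mul_of_memLp_four (h.memLp_sub hL _ _) (h.memLp_sub hL _ _)).const_mul _).const_mul _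

variable [IsFiniteMeasure P] {K : ℝ} {g : ℝ → ℝ}

theorem integrable_sub_mul_comp (h : IsExchangeable P b U) (hL : MemLp (U ∅) 4 P)
    (hg : IsSteinFunction K g) (A B C : Finset ι) :
    Integrable (fun ω => (U A ω - U B ω) * g (b ω + U C ω)) P :=
  hg.integrable_mul_comp ((h.memLp_sub hL A B).integrable (by norm_num)) (h.aemeasurable_add C)

theorem integrable_sub_mul_sub_mul_deriv (h : IsExchangeable P b U) (hL : MemLp (U ∅) 4 P)
    (hg : IsSteinFunction K g) (A B C D : Finset ι) :
    Integrable (fun ω => (U A ω - U B ω) * (U C ω - U D ω) * deriv g (b ω + U ∅ ω)) P :=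
  hg.integrable_mul_deriv_comp ((memLp_two_mul_of_memLp_four (h.memLp_sub hL A B)
    (h.memLp_sub hL C D)).integrable (by norm_num)) (h.aemeasurable_add ∅)

theorem integral_mul_deriv_sub_le (h : IsExchangeable P b U) (hL : MemLp (U ∅) 4 P)
    (hg : IsSteinFunction K g) (hK : 0 < K) {A : Finset ι} {j : ι} (hj : j ∉ A) :
    ∫ ω, (U ∅ ω - U {j} ω) * (U A ω - U (insert j A) ω) * deriv g (b ω + U ∅ ω) ∂P -
        1 / K * ∫ ω, |U ∅ ω - U {j} ω| ^ 3 ∂P ≤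
      2 * ∫ ω, (U A ω - U (insert j A) ω) * g (b ω + U ∅ ω) ∂P := by
  have hcube : ∀ B C, Integrable (fun ω => |U B ω - U C ω| ^ 3) P := fun B C =>
    integrable_abs_pow_three_of_memLp_four (h.memLp_sub hL B C)
  have herr : Integrable (fun ω =>
      1 / K * ((2 * |U ∅ ω - U {j} ω| ^ 3 + |U A ω - U (insert j A) ω| ^ 3) / 3)) P :=
    ((((hcube _ _).const_mul 2).add (hcube _ _)).div_const 3).const_mul _
  have hmain := h.integrable_sub_mul_sub_mul_deriv hL hg ∅ {j} A (insert j A)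
  have hgi := h.integrable_sub_mul_comp hL hg A (insert j A)
  calc _ = ∫ ω, ((U ∅ ω - U {j} ω) * (U A ω - U (insert j A) ω) * deriv g (b ω + U ∅ ω) -
          1 / K * ((2 * |U ∅ ω - U {j} ω| ^ 3 + |U A ω - U (insert j A) ω| ^ 3) / 3)) ∂P := by
        rw [integral_sub hmain herr, integral_const_mul, integral_div,
          integral_add ((hcube _ _).const_mul 2) (hcube _ _), integral_const_mul,
          h.integral_abs_sub_insert_pow_three hj]
        ring
    _ ≤ ∫ ω, ((U A ω - U (insert j A) ω) * g (b ω + U ∅ ω) -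
          (U A ω - U (insert j A) ω) * g (b ω + U {j} ω)) ∂P := by
        refine integral_mono (hmain.sub herr) ((hgi ∅).sub (hgi {j})) fun ω => ?_
        simpa only [add_sub_add_left_eq_sub, mul_sub (U A ω - U (insert j A) ω)] using
          hg.mul_mul_deriv_sub_le hK (b ω + U ∅ ω) (b ω + U {j} ω) (U A ω - U (insert j A) ω)
    _ = _ := by
        rw [integral_sub (hgi ∅) (hgi {j}),
          h.integral_sub_insert_mul hj hg.continuous.measurable]
        ring

variable [Fintype ι]

theorem integral_mul_comp_eq_sum (h : IsExchangeable P b U) (hL : MemLp (U ∅) 4 P)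
    (hg : IsSteinFunction K g) (hfull : ∫ ω, U Finset.univ ω * g (b ω + U ∅ ω) ∂P = 0) :
    ∫ ω, U ∅ ω * g (b ω + U ∅ ω) ∂P = ∑ A, subsetWeight A * ∑ j ∈ Aᶜ,
      ∫ ω, (U A ω - U (insert j A) ω) * g (b ω + U ∅ ω) ∂P := by
  have hgi : ∀ A, Integrable (fun ω => U A ω * g (b ω + U ∅ ω)) P := fun A =>
    hg.integrable_mul_comp ((h.memLp hL A).integrable (by norm_num)) (h.aemeasurable_add ∅)
  simp_rw [sub_mul, fun A B => integral_sub (hgi A) (hgi B)]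
  rw [sum_subsetWeight_mul_sum_sub fun A => ∫ ω, U A ω * g (b ω + U ∅ ω) ∂P, hfull, sub_zero]

theorem integral_exchangeStat_mul_deriv (h : IsExchangeable P b U) (hL : MemLp (U ∅) 4 P)
    (hg : IsSteinFunction K g) :
    ∫ ω, exchangeStat U ω * deriv g (b ω + U ∅ ω) ∂P = 1 / 2 * ∑ A, subsetWeight A * ∑ j ∈ Aᶜ,
      ∫ ω, (U ∅ ω - U {j} ω) * (U A ω - U (insert j A) ω) * deriv g (b ω + U ∅ ω) ∂P := by
  have hi := h.integrable_sub_mul_sub_mul_deriv hL hg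
  simp_rw [exchangeStat, mul_assoc (1 / 2 : ℝ), Finset.sum_mul, mul_assoc (subsetWeight _),
    Finset.sum_mul]
  rw [integral_const_mul, integral_finsetSum _ fun A _ =>
    (integrable_finsetSum _ fun j _ => hi _ _ _ _).const_mul _]
  simp_rw [integral_const_mul, fun A : Finset ι => integral_finsetSum Aᶜ fun j _ =>
    hi ∅ {j} A (insert j A)]

/-- Exchanging the `j`-th coordinates in `E[(U A - U (A ∪ {j})) g(b + U ∅)]` changes the sign of
the increment and replaces `g(b + U ∅)` by `g(b + U {j})`, so that Taylor's formula applies to the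
average of the two expressions. -/
theorem integral_exchangeStat_mul_deriv_sub_le (h : IsExchangeable P b U)
    (hL : MemLp (U ∅) 4 P) (hg : IsSteinFunction K g) (hK : 0 < K)
    (hfull : ∫ ω, U Finset.univ ω * g (b ω + U ∅ ω) ∂P = 0) :
    ∫ ω, exchangeStat U ω * deriv g (b ω + U ∅ ω) ∂P -
        1 / (2 * K) * ∑ j, ∫ ω, |U ∅ ω - U {j} ω| ^ 3 ∂P ≤
      ∫ ω, U ∅ ω * g (b ω + U ∅ ω) ∂P := by
  have hsum := sum_subsetWeight_mul_sum_compl_le fun A j => h.integral_mul_deriv_sub_le hL hg hK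
    (A := A) (j := j)
  simp only [Finset.sum_sub_distrib, mul_sub (subsetWeight _), sum_subsetWeight_mul_sum_compl]
    at hsum
  simp only [← Finset.mul_sum, mul_left_comm _ (2 : ℝ)] at hsum
  rw [h.integral_exchangeStat_mul_deriv hL hg, h.integral_mul_comp_eq_sum hL hg hfull,
    show 1 / (2 * K) = 1 / 2 * (1 / K) by field_simp]
  linarith

end IsExchangeable

end Exchange

section Probability

variable {Ω : Type*} {mΩ : MeasurableSpace Ω} {P : Measure Ω} [IsProbabilityMeasure P]

theorem integral_abs_pow_le {f : Ω → ℝ} {p q : ℕ} (hp : p ≠ 0) (hpq : p ≤ q) (hf : MemLp f q P) :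
    ∫ ω, |f ω| ^ p ∂P ≤ (∫ ω, |f ω| ^ q ∂P) ^ (p / q : ℝ) := by
  have hp' : (p : ℝ) ≠ 0 := Nat.cast_ne_zero.2 hp
  have hq' : (q : ℝ) ≠ 0 := Nat.cast_ne_zero.2 (by lia)
  have hratio : 1 ≤ (q / p : ℝ) := (one_le_div (by positivity)).2 (Nat.cast_le.2 hpq)
  have hpow : ∀ ω, (|f ω| ^ p) ^ (q / p : ℝ) = |f ω| ^ q := fun ω => by
    rw [← Real.rpow_natCast_mul (abs_nonneg _), mul_div_cancel₀ _ hp', Real.rpow_natCast]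
  have hintp : Integrable (fun ω => |f ω| ^ p) P :=
    (hf.mono_exponent (Nat.cast_le.2 hpq)).integrable_norm_pow hp
  have hintq : Integrable (fun ω => |f ω| ^ q) P := hf.integrable_norm_pow (by lia)
  have hjensen := (convexOn_rpow hratio).map_integral_le (μ := P) (f := fun ω => |f ω| ^ p)
    (Real.continuous_rpow_const (by positivity)).continuousOn isClosed_Ici
    (ae_of_all _ fun ω => mem_Ici.2 (by positivity)) hintp
    (by simpa only [Function.comp_def, hpow] using hintq)
  simp only [hpow] at hjensen
  have hnonneg : 0 ≤ ∫ ω, |f ω| ^ p ∂P := integral_nonneg fun ω => by positivity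
  calc ∫ ω, |f ω| ^ p ∂P = ((∫ ω, |f ω| ^ p ∂P) ^ (q / p : ℝ)) ^ (p / q : ℝ) := by
        rw [← Real.rpow_mul hnonneg, div_mul_div_cancel₀ hp', div_self hq', Real.rpow_one]
    _ ≤ _ := Real.rpow_le_rpow (by positivity) hjensen (by positivity)

theorem integral_mul_le_mul_sqrt_integral_sq {Y H : Ω → ℝ} (hY : MemLp Y 2 P) {c : ℝ}
    (hH : ∀ ω, |H ω| ≤ c) : ∫ ω, Y ω * H ω ∂P ≤ c * √(∫ ω, Y ω ^ 2 ∂P) := by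
  obtain ⟨ω₀⟩ := P.nonempty_of_neZero
  have hc : 0 ≤ c := (abs_nonneg _).trans (hH ω₀)
  have hlyapunov := integral_abs_pow_le (p := 1) (q := 2) one_ne_zero one_le_two
    (by exact_mod_cast hY)
  have hYH : ∀ ω, |Y ω * H ω| ≤ c * |Y ω| := fun ω => by
    rw [abs_mul, mul_comm]
    exact mul_le_mul_of_nonneg_right (hH ω) (abs_nonneg _)
  calc ∫ ω, Y ω * H ω ∂P ≤ ∫ ω, |Y ω * H ω| ∂P := (le_abs_self _).trans abs_integral_le_integral_abs
    _ ≤ ∫ ω, c * |Y ω| ∂P := integral_mono_of_nonneg (ae_of_all _ fun ω => abs_nonneg _)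
        ((hY.integrable one_le_two).abs.const_mul c) (ae_of_all _ hYH)
    _ ≤ c * √(∫ ω, Y ω ^ 2 ∂P) := by
        rw [integral_const_mul]
        gcongr
        simpa [Real.sqrt_eq_rpow] using hlyapunov

theorem integral_condExp_mul {m : MeasurableSpace Ω} (hm : m ≤ mΩ) {Y H : Ω → ℝ}
    (hH : StronglyMeasurable[m] H) (hY : Integrable Y P)
    (hYH : Integrable (fun ω => Y ω * H ω) P) :
    ∫ ω, P[Y | m] ω * H ω ∂P = ∫ ω, Y ω * H ω ∂P :=
  (integral_congr_ae (condExp_mul_of_stronglyMeasurable_right hH hYH hY)).symm.trans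
    (integral_condExp hm)

theorem indepFun_prodMk_of_indepFun {α β γ : Type*} [MeasurableSpace α] [MeasurableSpace β]
    [MeasurableSpace γ] {X : Ω → α} {Y : Ω → β} {Z : Ω → γ} (hX : AEMeasurable X P)
    (hY : AEMeasurable Y P) (hZ : AEMeasurable Z P) (hYZ : IndepFun Y Z P)
    (hXYZ : IndepFun X (fun ω => (Y ω, Z ω)) P) : IndepFun (fun ω => (X ω, Y ω)) Z P := by
  have := Measure.isProbabilityMeasure_map hX
  have := Measure.isProbabilityMeasure_map hY
  have := Measure.isProbabilityMeasure_map hZ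
  have htriple := hXYZ.map_prod_eq_prod_map_map hX (hY.prodMk hZ)
  have hXY : IndepFun X Y P := hXYZ.comp measurable_id measurable_fst
  rw [hYZ.map_prod_eq_prod_map_map hY hZ] at htriple
  rw [indepFun_iff_map_prod_eq_prod_map_map (hX.prodMk hY) hZ,
    hXY.map_prod_eq_prod_map_map hX hY,
    ← ((measurePreserving_prodAssoc (P.map X) (P.map Y) (P.map Z)).symm _).map_eq, ← htriple,
    AEMeasurable.map_map_of_aemeasurable (MeasurableEquiv.measurable _).aemeasurable
      (hX.prodMk (hY.prodMk hZ))]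
  rfl

end Probability

theorem IsExchangeable.wassersteinOne_add_le {Ω ι : Type*} {mΩ : MeasurableSpace Ω} [Fintype ι]
    [DecidableEq ι] {P : Measure Ω} [IsProbabilityMeasure P] {b : Ω → ℝ} {U : Finset ι → Ω → ℝ}
    (h : IsExchangeable P b U) (hL : MemLp (U ∅) 4 P) {v : ℝ≥0}
    (hlaw : P.map b = gaussianReal 0 v) (hbU : IndepFun b (U ∅) P)
    (hV : Measurable fun ω => b ω + U ∅ ω)
    (hfull : IndepFun (U Finset.univ) (fun ω => b ω + U ∅ ω) P)
    (hmean : ∫ ω, U Finset.univ ω ∂P = 0) {K : ℝ} (hK : 0 < K) :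
    wassersteinOne (P.map fun ω => b ω + U ∅ ω) (gaussianReal 0 K.toNNReal) ≤
      ENNReal.ofReal (√(2 / (K * Real.pi)) * √(∫ ω, (P[fun ω' => K - v - exchangeStat U ω' |
          MeasurableSpace.comap (fun ω' => b ω' + U ∅ ω') inferInstance]) ω ^ 2 ∂P) +
        1 / (2 * K) * ∑ j, ∫ ω, |U ∅ ω - U {j} ω| ^ 3 ∂P) := by
  have hU := (h.memLp hL ∅).integrable (by norm_num)
  refine wassersteinOne_gaussian_add_le hlaw hU hbU hK fun g hg => ?_
  have hgm := hg.continuous.measurable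
  have hdg := hg.continuous_deriv.measurable
  have hzero : ∫ ω, U Finset.univ ω * g (b ω + U ∅ ω) ∂P = 0 := by
    have hmul := (hfull.comp measurable_id hgm).integral_fun_mul_eq_mul_integral
      (h.memLp hL _).aestronglyMeasurable (hgm.comp hV).aestronglyMeasurable
    simpa only [Function.comp_def, id_eq, hmean, zero_mul] using hmul
  have hY : MemLp (fun ω => K - v - exchangeStat U ω) 2 P :=
    (memLp_const _).sub (h.memLp_two_exchangeStat hL)
  have hYi := hY.integrable one_le_two
  have hdrift : ∫ ω, ((K - v) * deriv g (b ω + U ∅ ω) - U ∅ ω * g (b ω + U ∅ ω)) ∂P =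
      ∫ ω, (K - v - exchangeStat U ω) * deriv g (b ω + U ∅ ω) ∂P +
        (∫ ω, exchangeStat U ω * deriv g (b ω + U ∅ ω) ∂P -
          ∫ ω, U ∅ ω * g (b ω + U ∅ ω) ∂P) := by
    have hd := hg.integrable_mul_deriv_comp (integrable_const (μ := P) (K - v : ℝ)) hV.aemeasurable
    have hT := hg.integrable_mul_deriv_comp
      ((h.memLp_two_exchangeStat hL).integrable one_le_two) hV.aemeasurable
    simp_rw [sub_mul _ (exchangeStat U _)]
    rw [integral_sub hd (hg.integrable_mul_comp hU hV.aemeasurable), integral_sub hd hT]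
    ring
  have hcond := integral_condExp_mul (H := fun ω => deriv g (b ω + U ∅ ω)) hV.comap_le
    (hdg.comp (comap_measurable fun ω => b ω + U ∅ ω)).stronglyMeasurable hYi
    (hg.integrable_mul_deriv_comp hYi hV.aemeasurable)
  rw [hdrift]
  refine add_le_add ?_ (by linarith [h.integral_exchangeStat_mul_deriv_sub_le hL hg hK hzero])
  rw [← hcond]
  exact integral_mul_le_mul_sqrt_integral_sq (hY.condExp one_le_two)
    fun ω => hg.abs_deriv_le (b ω + U ∅ ω)

section Resampling

variable {k : ℕ} {E : Type*}

theorem resample_empty (x x' : Fin k → E) : resample x x' ∅ = x := by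
  ext i
  simp [resample]

theorem resample_univ (x x' : Fin k → E) : resample x x' Finset.univ = x' := by
  ext i
  simp [resample]

theorem update_resample (x x' : Fin k → E) (A : Finset (Fin k)) (j : Fin k) :
    Function.update (resample x x' A) j (x' j) = resample x x' (insert j A) := by
  ext i
  by_cases h : i = j
  · simp [resample, h]
  · simp [resample, h]

theorem resample_resample (x x' : Fin k → E) (A S : Finset (Fin k)) :
    resample (resample x x' S) (resample x' x S) A = resample x x' (symmDiff A S) := by
  ext i
  by_cases h : i ∈ A <;> by_cases h' : i ∈ S <;> simp [resample, h, h', Finset.mem_symmDiff]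

theorem discreteDiff_resample (f : (Fin k → E) → ℝ) (x x' : Fin k → E) (A : Finset (Fin k))
    (j : Fin k) : discreteDiff f x' j (resample x x' A) =
      f (resample x x' A) - f (resample x x' (insert j A)) := by
  rw [discreteDiff, update_resample]

theorem discreteDiff_eq_sub_resample (f : (Fin k → E) → ℝ) (x x' : Fin k → E) (j : Fin k) :
    discreteDiff f x' j x = f (resample x x' ∅) - f (resample x x' {j}) := by
  simpa only [resample_empty, insert_empty_eq] using discreteDiff_resample f x x' ∅ j

theorem steinT_eq_exchangeStat (f : (Fin k → E) → ℝ) {Ω : Type*} (X X' : Ω → Fin k → E) (ω : Ω) :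
    steinT f (X ω) (X' ω) = exchangeStat (fun A ω => f (resample (X ω) (X' ω) A)) ω := by
  simp only [steinT, exchangeStat, discreteDiff_resample, subsetWeight, Fintype.card_fin]
  simp only [discreteDiff_eq_sub_resample]
  congr 1
  refine Finset.sum_subset (Finset.subset_univ (Finset.univ : Finset (Fin k)).ssubsets)
    fun A _ hA => ?_
  rw [Finset.mem_ssubsets, Finset.ssubset_univ_iff, not_not] at hA
  simp [hA]

variable [MeasurableSpace E]

theorem measurable_resample (A : Finset (Fin k)) :
    Measurable fun p : (Fin k → E) × (Fin k → E) => resample p.1 p.2 A := by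
  refine measurable_pi_lambda _ fun i => ?_
  by_cases h : i ∈ A
  · simp only [resample, h, if_true]
    fun_prop
  · simp only [resample, h, if_false]
    fun_prop

theorem measurePreserving_resample (μ : Fin k → Measure E) [∀ i, IsProbabilityMeasure (μ i)]
    (S : Finset (Fin k)) :
    MeasurePreserving
      (fun p : (Fin k → E) × (Fin k → E) => (resample p.1 p.2 S, resample p.2 p.1 S))
      ((Measure.pi μ).prod (Measure.pi μ)) ((Measure.pi μ).prod (Measure.pi μ)) := by
  have hzip := measurePreserving_arrowProdEquivProdArrow E E (Fin k) μ μ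
  have hswap : MeasurePreserving (fun (q : Fin k → E × E) i => if i ∈ S then (q i).swap else q i)
      (Measure.pi fun i => (μ i).prod (μ i)) (Measure.pi fun i => (μ i).prod (μ i)) := by
    refine measurePreserving_pi _ _ (f := fun i p => if i ∈ S then Prod.swap p else p) fun i => ?_
    by_cases h : i ∈ S
    · simpa only [h, if_true] using Measure.measurePreserving_swap
    · simp only [h, if_false]
      exact MeasurePreserving.id _
  convert (hzip.comp hswap).comp hzip.symm using 1
  ext p i
  all_goals
    by_cases hi : i ∈ S <;>
      simp [resample, hi, MeasurableEquiv.arrowProdEquivProdArrow, Equiv.arrowProdEquivProdArrow]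

variable {Ω : Type*} {mΩ : MeasurableSpace Ω} {P : Measure Ω}

/-- `X` is a random vector with independent entries, `X'` is an independent copy of it, and the
bias `b` is independent of both. -/
structure IsResamplingPair (P : Measure Ω) (X X' : Fin k → Ω → E) (b : Ω → ℝ) : Prop where
  measurable (i : Fin k) : Measurable (X i)
  measurable_copy (i : Fin k) : Measurable (X' i)
  measurable_bias : Measurable b
  iIndepFun : iIndepFun X P
  map_copy : P.map (fun ω i => X' i ω) = P.map (fun ω i => X i ω)
  indepFun_copy : IndepFun (fun ω i => X i ω) (fun ω i => X' i ω) P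
  indepFun_bias : IndepFun b (fun ω => ((fun i => X i ω), (fun i => X' i ω))) P

namespace IsResamplingPair

variable {X X' : Fin k → Ω → E} {b : Ω → ℝ}

theorem measurable_joint (h : IsResamplingPair P X X' b) :
    Measurable fun ω => (b ω, ((fun i => X i ω), (fun i => X' i ω))) :=
  h.measurable_bias.prodMk
    ((measurable_pi_lambda _ h.measurable).prodMk (measurable_pi_lambda _ h.measurable_copy))

theorem integral_copy (h : IsResamplingPair P X X' b) {f : (Fin k → E) → ℝ} (hf : Measurable f) :
    ∫ ω, f (fun i => X' i ω) ∂P = ∫ ω, f (fun i => X i ω) ∂P := by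
  rw [← integral_map h.measurable_joint.snd.snd.aemeasurable hf.aestronglyMeasurable, h.map_copy,
    integral_map h.measurable_joint.snd.fst.aemeasurable hf.aestronglyMeasurable]

variable [IsProbabilityMeasure P]

theorem map_joint (h : IsResamplingPair P X X' b) :
    P.map (fun ω => (b ω, ((fun i => X i ω), (fun i => X' i ω)))) = (P.map b).prod
      ((Measure.pi fun i => P.map (X i)).prod (Measure.pi fun i => P.map (X i))) := by
  rw [h.indepFun_bias.map_prod_eq_prod_map_map h.measurable_bias.aemeasurable
      h.measurable_joint.snd.aemeasurable,
    h.indepFun_copy.map_prod_eq_prod_map_map h.measurable_joint.snd.fst.aemeasurable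
      h.measurable_joint.snd.snd.aemeasurable,
    h.map_copy, h.iIndepFun.map_fun_eq_pi_map fun i => (h.measurable i).aemeasurable]

theorem identDistrib_resample (h : IsResamplingPair P X X' b) (S : Finset (Fin k)) :
    IdentDistrib (fun ω => (b ω, ((fun i => X i ω), (fun i => X' i ω))))
      (fun ω => (b ω, (resample (fun i => X i ω) (fun i => X' i ω) S,
        resample (fun i => X' i ω) (fun i => X i ω) S))) P P := by
  have hprob : ∀ i, IsProbabilityMeasure (P.map (X i)) := fun i =>
    Measure.isProbabilityMeasure_map (h.measurable i).aemeasurable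
  have := Measure.isProbabilityMeasure_map (μ := P) h.measurable_bias.aemeasurable
  have hpres := (MeasurePreserving.id (P.map b)).prod
    (measurePreserving_resample (fun i => P.map (X i)) S)
  rw [← h.map_joint] at hpres
  refine ⟨h.measurable_joint.aemeasurable,
    (hpres.measurable.comp h.measurable_joint).aemeasurable, ?_⟩
  exact hpres.map_eq.symm.trans (Measure.map_map hpres.measurable h.measurable_joint)

theorem isExchangeable (h : IsResamplingPair P X X' b) {f : (Fin k → E) → ℝ}
    (hf : Measurable f) :
    IsExchangeable P b fun A ω => f (resample (fun i => X i ω) (fun i => X' i ω) A) := fun S => by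
  have heval : Measurable fun q : ℝ × ((Fin k → E) × (Fin k → E)) =>
      (q.1, fun A : Finset (Fin k) => f (resample q.2.1 q.2.2 A)) :=
    measurable_fst.prodMk (measurable_pi_lambda _ fun A =>
      hf.comp ((measurable_resample A).comp measurable_snd))
  simpa only [Function.comp_def, resample_resample] using (h.identDistrib_resample S).comp heval

theorem indepFun_copy_add (h : IsResamplingPair P X X' b) {f : (Fin k → E) → ℝ}
    (hf : Measurable f) :
    IndepFun (fun ω => f fun i => X' i ω) (fun ω => b ω + f fun i => X i ω) P := by
  have hpair := indepFun_prodMk_of_indepFun h.measurable_bias.aemeasurable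
    h.measurable_joint.snd.fst.aemeasurable h.measurable_joint.snd.snd.aemeasurable
    h.indepFun_copy h.indepFun_bias
  exact (hpair.comp (φ := fun p : ℝ × (Fin k → E) => p.1 + f p.2) (by fun_prop) hf).symm

theorem wassersteinOne_add_le (h : IsResamplingPair P X X' b) {v : ℝ≥0} {K : ℝ} (hK : 0 < K)
    (hlaw : P.map b = gaussianReal 0 v) {f : (Fin k → E) → ℝ} (hf : Measurable f)
    (hL : Integrable (fun ω => f (fun i => X i ω) ^ 4) P)
    (hmean : ∫ ω, f (fun i => X i ω) ∂P = 0) :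
    wassersteinOne (P.map fun ω => b ω + f fun i => X i ω) (gaussianReal 0 K.toNNReal) ≤
      ENNReal.ofReal
        (√(2 / (K * Real.pi)) *
            √(∫ ω, (P[fun ω' => K - v - steinT f (fun i => X i ω') (fun i => X' i ω') |
              MeasurableSpace.comap (fun ω' => b ω' + f fun i => X i ω') inferInstance]) ω ^ 2 ∂P)
          + 1 / (2 * K) * ∑ j, ∫ ω,
              |discreteDiff f (fun i => X' i ω) j (fun i => X i ω)| ^ 3 ∂P) := by
  have hfX : Measurable fun ω => f fun i => X i ω := hf.comp h.measurable_joint.snd.fst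
  have hbound := (h.isExchangeable hf).wassersteinOne_add_le (K := K) (v := v)
  simp only [resample_empty, resample_univ] at hbound
  simp only [steinT_eq_exchangeStat f (fun ω i => X i ω) (fun ω i => X' i ω),
    discreteDiff_eq_sub_resample, resample_empty]
  exact hbound ((memLp_four_iff_integrable_pow hfX.aestronglyMeasurable).2 hL) hlaw
    (h.indepFun_bias.comp measurable_id (hf.comp measurable_fst))
    (h.measurable_bias.add hfX) (h.indepFun_copy_add hf) (h.integral_copy hf ▸ hmean) hK

end IsResamplingPair

end Resampling

theorem integral_sum_sq_of_orthogonal {Ω ι : Type*} [MeasurableSpace Ω] [Fintype ι]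
    {P : Measure Ω} {Z : ι → Ω → ℝ} (hZ : ∀ i, MemLp (Z i) 2 P)
    (hortho : Pairwise fun i j => ∫ ω, Z i ω * Z j ω ∂P = 0) :
    ∫ ω, (∑ i, Z i ω) ^ 2 ∂P = ∑ i, ∫ ω, Z i ω ^ 2 ∂P := by
  have hint : ∀ i j, Integrable (fun ω => Z i ω * Z j ω) P := fun i j =>
    (hZ i).integrable_mul (hZ j)
  simp only [pow_two, Finset.sum_mul_sum]
  rw [integral_finsetSum _ fun i _ => integrable_finsetSum _ fun j _ => hint i j]
  refine Finset.sum_congr rfl fun i _ => ?_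
  rw [integral_finsetSum _ fun j _ => hint i j]
  exact Finset.sum_eq_single i (fun j _ hj => hortho hj.symm) (by simp)

section LinearForm

variable {Ω ι : Type*} [MeasurableSpace Ω]

/-- Independent standardized weights `W`, random coefficients `a` and a bias `b`, the setting for
the statistic `b + ∑ j, a j * W j`. The bias is independent of everything else, and so is each
single weight. -/
structure IsRandomLinearForm (P : Measure Ω) (b : Ω → ℝ) (W a : ι → Ω → ℝ) : Prop where
  measurable_bias : Measurable b
  measurable_weight (j : ι) : Measurable (W j)
  measurable_coeff (j : ι) : Measurable (a j)
  memLp_weight (j : ι) : MemLp (W j) 4 P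
  memLp_coeff (j : ι) : MemLp (a j) 4 P
  integral_weight (j : ι) : ∫ ω, W j ω ∂P = 0
  integral_weight_sq (j : ι) : ∫ ω, W j ω ^ 2 ∂P = 1
  indepFun_bias : IndepFun b (fun ω => ((fun i => W i ω), (fun i => a i ω))) P
  indepFun_weight (j : ι) : IndepFun (W j)
    (fun ω => (b ω, (fun i : {i // i ≠ j} => W i ω), (fun i => a i ω))) P

namespace IsRandomLinearForm

variable {P : Measure Ω} {b : Ω → ℝ} {W a : ι → Ω → ℝ}

theorem indepFun_weight_coeff (h : IsRandomLinearForm P b W a) (j : ι) :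
    IndepFun (W j) (a j) P :=
  (h.indepFun_weight j).comp measurable_id
    (ψ := fun q : ℝ × ({i // i ≠ j} → ℝ) × (ι → ℝ) => q.2.2 j) (by fun_prop)

theorem memLp_coeff_mul_weight (h : IsRandomLinearForm P b W a) (j : ι) :
    MemLp (fun ω => a j ω * W j ω) 4 P := by
  have ha := h.measurable_coeff j
  have hW := h.measurable_weight j
  rw [memLp_four_iff_integrable_pow (by fun_prop)]
  have hpow := ((h.indepFun_weight_coeff j).symm.comp (φ := fun x : ℝ => x ^ 4)
    (ψ := fun x : ℝ => x ^ 4) (by fun_prop) (by fun_prop)).integrable_mul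
    ((memLp_four_iff_integrable_pow (by fun_prop)).1 (h.memLp_coeff j))
    ((memLp_four_iff_integrable_pow (by fun_prop)).1 (h.memLp_weight j))
  simpa only [mul_pow, Pi.mul_def, Function.comp_def] using hpow

theorem memLp_two_sq_mul_sq_sub_one (h : IsRandomLinearForm P b W a) (j : ι) :
    MemLp (fun ω => a j ω ^ 2 * (W j ω ^ 2 - 1)) 2 P := by
  have hdiff := (memLp_two_mul_of_memLp_four (h.memLp_coeff_mul_weight j)
    (h.memLp_coeff_mul_weight j)).sub
    (memLp_two_mul_of_memLp_four (h.memLp_coeff j) (h.memLp_coeff j))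
  refine (memLp_congr_ae (ae_of_all _ fun ω => ?_)).1 hdiff
  simp only [Pi.sub_apply]
  ring

theorem integral_abs_coeff_mul_weight_pow_three (h : IsRandomLinearForm P b W a) (j : ι) :
    ∫ ω, |a j ω * W j ω| ^ 3 ∂P = (∫ ω, |a j ω| ^ 3 ∂P) * ∫ ω, |W j ω| ^ 3 ∂P := by
  have ha := h.measurable_coeff j
  have hW := h.measurable_weight j
  have hmul := ((h.indepFun_weight_coeff j).symm.comp (φ := fun x : ℝ => |x| ^ 3)
    (ψ := fun x : ℝ => |x| ^ 3) (by fun_prop) (by fun_prop)).integral_fun_mul_eq_mul_integral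
    (by fun_prop) (by fun_prop)
  simpa only [abs_mul, mul_pow, Function.comp_def] using hmul

section SecondMoment

variable [IsProbabilityMeasure P]

theorem integrable_weight_sq (h : IsRandomLinearForm P b W a) (j : ι) :
    Integrable (fun ω => W j ω ^ 2) P :=
  ((h.memLp_weight j).mono_exponent (by norm_num)).integrable_sq

theorem integral_weight_sq_sub_one (h : IsRandomLinearForm P b W a) (j : ι) :
    ∫ ω, (W j ω ^ 2 - 1) ∂P = 0 := by
  rw [integral_sub (h.integrable_weight_sq j) (integrable_const 1), h.integral_weight_sq]
  simp

theorem integral_sq_weight_sq_sub_one (h : IsRandomLinearForm P b W a) (j : ι) :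
    ∫ ω, (W j ω ^ 2 - 1) ^ 2 ∂P = ∫ ω, W j ω ^ 4 ∂P - 1 := by
  have hW := h.measurable_weight j
  have hexpand : ∀ ω, (W j ω ^ 2 - 1) ^ 2 = W j ω ^ 4 - (2 * W j ω ^ 2 - 1) := fun ω => by ring
  have hfour := (memLp_four_iff_integrable_pow (by fun_prop)).1 (h.memLp_weight j)
  have htwo := (h.integrable_weight_sq j).const_mul 2
  have hrest : Integrable (fun ω => 2 * W j ω ^ 2 - 1) P := htwo.sub (integrable_const 1)
  simp only [hexpand]
  rw [integral_sub hfour hrest, integral_sub htwo (integrable_const 1),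
    integral_const_mul, h.integral_weight_sq, integral_const, probReal_univ]
  norm_num

theorem integral_sq_mul_sq_sub_one_sq (h : IsRandomLinearForm P b W a) (j : ι) :
    ∫ ω, (a j ω ^ 2 * (W j ω ^ 2 - 1)) ^ 2 ∂P =
      (∫ ω, a j ω ^ 4 ∂P) * (∫ ω, W j ω ^ 4 ∂P - 1) := by
  have ha := h.measurable_coeff j
  have hW := h.measurable_weight j
  have hmul := ((h.indepFun_weight_coeff j).symm.comp (φ := fun x : ℝ => x ^ 4)
    (ψ := fun x : ℝ => (x ^ 2 - 1) ^ 2) (by fun_prop)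
    (by fun_prop)).integral_fun_mul_eq_mul_integral (by fun_prop) (by fun_prop)
  simp only [Function.comp_def, h.integral_sq_weight_sq_sub_one] at hmul
  simpa only [mul_pow, ← pow_mul] using hmul

theorem integral_sq_mul_sq_sub_one_mul (h : IsRandomLinearForm P b W a) {i j : ι} (hij : i ≠ j) :
    ∫ ω, (a i ω ^ 2 * (W i ω ^ 2 - 1)) * (a j ω ^ 2 * (W j ω ^ 2 - 1)) ∂P = 0 := by
  have ha := h.measurable_coeff
  have hW := h.measurable_weight
  have hmul := ((h.indepFun_weight j).comp (φ := fun x : ℝ => x ^ 2 - 1)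
    (ψ := fun q : ℝ × ({i // i ≠ j} → ℝ) × (ι → ℝ) =>
      q.2.2 i ^ 2 * (q.2.1 ⟨i, hij⟩ ^ 2 - 1) * q.2.2 j ^ 2)
    (by fun_prop) (by fun_prop)).integral_fun_mul_eq_mul_integral (by fun_prop) (by fun_prop)
  simp only [Function.comp_def, h.integral_weight_sq_sub_one, zero_mul] at hmul
  rw [← hmul]
  congr with ω
  ring

theorem integral_sum_sq_mul_sq_sub_one_sq [Fintype ι] (h : IsRandomLinearForm P b W a) :
    ∫ ω, (∑ j, a j ω ^ 2 * (W j ω ^ 2 - 1)) ^ 2 ∂P =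
      ∑ j, (∫ ω, a j ω ^ 4 ∂P) * (∫ ω, W j ω ^ 4 ∂P - 1) := by
  rw [integral_sum_sq_of_orthogonal h.memLp_two_sq_mul_sq_sub_one
    fun i j => h.integral_sq_mul_sq_sub_one_mul]
  exact Finset.sum_congr rfl fun j _ => h.integral_sq_mul_sq_sub_one_sq j

end SecondMoment

variable [Fintype ι]

theorem measurable_add_sum (h : IsRandomLinearForm P b W a) :
    Measurable fun ω => b ω + ∑ i, a i ω * W i ω :=
  h.measurable_bias.add (Finset.measurable_fun_sum _ fun i _ =>
    (h.measurable_coeff i).mul (h.measurable_weight i))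

theorem integral_mul_comp_leaveOneOut (h : IsRandomLinearForm P b W a) {g : ℝ → ℝ}
    (hg : Measurable g) (j : ι) :
    ∫ ω, a j ω * W j ω * g (b ω + ∑ i, a i ω * W i ω - a j ω * W j ω) ∂P = 0 := by
  classical
  have hb := h.measurable_bias
  have ha := h.measurable_coeff
  have hW := h.measurable_weight
  have hmul := ((h.indepFun_weight j).comp (φ := id)
    (ψ := fun q : ℝ × ({i // i ≠ j} → ℝ) × (ι → ℝ) =>
      q.2.2 j * g (q.1 + ∑ i : {i // i ≠ j}, q.2.2 i * q.2.1 i))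
    (by fun_prop) (by fun_prop)).integral_fun_mul_eq_mul_integral (by fun_prop) (by fun_prop)
  simp only [Function.comp_def, id_eq, h.integral_weight, zero_mul] at hmul
  rw [← hmul]
  congr with ω
  rw [Fintype.sum_eq_add_sum_subtype_ne (fun i => a i ω * W i ω) j, add_left_comm,
    add_sub_cancel_left]
  ring

variable [IsProbabilityMeasure P] {K : ℝ} {g : ℝ → ℝ}

theorem integrable_sq_mul_deriv_comp (h : IsRandomLinearForm P b W a) (hg : IsSteinFunction K g)
    (j : ι) : Integrable
      (fun ω => (a j ω * W j ω) ^ 2 * deriv g (b ω + ∑ i, a i ω * W i ω)) P :=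
  hg.integrable_mul_deriv_comp
    ((h.memLp_coeff_mul_weight j).mono_exponent (by norm_num)).integrable_sq
    h.measurable_add_sum.aemeasurable

theorem integrable_mul_comp (h : IsRandomLinearForm P b W a) (hg : IsSteinFunction K g) (j : ι) :
    Integrable (fun ω => a j ω * W j ω * g (b ω + ∑ i, a i ω * W i ω)) P :=
  hg.integrable_mul_comp ((h.memLp_coeff_mul_weight j).integrable (by norm_num))
    h.measurable_add_sum.aemeasurable

theorem integral_sq_mul_deriv_comp_sub_le (h : IsRandomLinearForm P b W a)
    (hg : IsSteinFunction K g) (hK : 0 < K) (j : ι) :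
    ∫ ω, (a j ω * W j ω) ^ 2 * deriv g (b ω + ∑ i, a i ω * W i ω) ∂P -
        ∫ ω, a j ω * W j ω * g (b ω + ∑ i, a i ω * W i ω) ∂P ≤
      1 / K * ((∫ ω, |a j ω| ^ 3 ∂P) * ∫ ω, |W j ω| ^ 3 ∂P) := by
  have hx := h.memLp_coeff_mul_weight j
  have hV := h.measurable_add_sum
  set V : Ω → ℝ := fun ω => b ω + ∑ i, a i ω * W i ω
  set y : Ω → ℝ := fun ω => a j ω * W j ω
  have hy : Measurable y := (h.measurable_coeff j).mul (h.measurable_weight j)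
  have hfull : Integrable (fun ω => y ω * g (V ω)) P := h.integrable_mul_comp hg j
  have hderiv : Integrable (fun ω => y ω ^ 2 * deriv g (V ω)) P :=
    h.integrable_sq_mul_deriv_comp hg j
  have hthird := (integrable_abs_pow_three_of_memLp_four hx).const_mul (1 / K)
  have hout : Integrable (fun ω => y ω * g (V ω - y ω)) P :=
    hg.integrable_mul_comp (hx.integrable (by norm_num)) (hV.sub hy).aemeasurable
  have htaylor : ∀ ω, y ω ^ 2 * deriv g (V ω) - 1 / K * |y ω| ^ 3 ≤
      y ω * g (V ω) - y ω * g (V ω - y ω) := fun ω => by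
    have := hg.mul_mul_deriv_sub_le hK (V ω) (V ω - y ω) (y ω)
    rw [sub_sub_cancel] at this
    linarith
  have hle := integral_mono (hderiv.sub hthird) (hfull.sub hout) htaylor
  simp only [Pi.sub_apply] at hle
  rw [integral_sub hderiv hthird, integral_sub hfull hout, integral_const_mul,
    h.integral_mul_comp_leaveOneOut hg.continuous.measurable j,
    h.integral_abs_coeff_mul_weight_pow_three j] at hle
  linarith

theorem integral_steinOperator_eq (h : IsRandomLinearForm P b W a) (hg : IsSteinFunction K g)
    (t : ℝ) :
    ∫ ω, (t * deriv g (b ω + ∑ i, a i ω * W i ω) -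
        (∑ i, a i ω * W i ω) * g (b ω + ∑ i, a i ω * W i ω)) ∂P =
      ∫ ω, (t - ∑ i, a i ω ^ 2) * deriv g (b ω + ∑ i, a i ω * W i ω) ∂P +
      ∫ ω, -(∑ i, a i ω ^ 2 * (W i ω ^ 2 - 1)) * deriv g (b ω + ∑ i, a i ω * W i ω) ∂P +
      ∑ j, (∫ ω, (a j ω * W j ω) ^ 2 * deriv g (b ω + ∑ i, a i ω * W i ω) ∂P -
        ∫ ω, a j ω * W j ω * g (b ω + ∑ i, a i ω * W i ω) ∂P) := by
  have hV := h.measurable_add_sum.aemeasurable (μ := P)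
  have hcoeff : Integrable (fun ω => t - ∑ i, a i ω ^ 2) P :=
    (integrable_const t).sub (integrable_finsetSum _ fun i _ =>
      ((h.memLp_coeff i).mono_exponent (by norm_num)).integrable_sq)
  have hfluct : Integrable (fun ω => -(∑ i, a i ω ^ 2 * (W i ω ^ 2 - 1))) P :=
    (integrable_finsetSum _ fun i _ =>
      (h.memLp_two_sq_mul_sq_sub_one i).integrable one_le_two).neg
  have hd := h.integrable_sq_mul_deriv_comp hg
  have hm := h.integrable_mul_comp hg
  have hI := hg.integrable_mul_deriv_comp hcoeff hV
  have hJ := hg.integrable_mul_deriv_comp hfluct hV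
  have hdm := fun j => (hd j).sub (hm j)
  have hIJ := hI.add hJ
  simp only [Pi.sub_def] at hdm
  simp only [Pi.add_def] at hIJ
  simp_rw [← integral_sub (hd _) (hm _)]
  rw [← integral_finsetSum _ fun j _ => hdm j, ← integral_add hI hJ,
    ← integral_add hIJ (integrable_finsetSum _ fun j _ => hdm j)]
  congr with ω
  simp only [Finset.sum_sub_distrib, mul_sub, mul_one, ← Finset.sum_mul, mul_pow]
  ring

theorem wassersteinOne_add_sum_le (h : IsRandomLinearForm P b W a) {v : ℝ≥0}
    (hlaw : P.map b = gaussianReal 0 v) (hK : 0 < K) :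
    wassersteinOne (P.map fun ω => b ω + ∑ j, a j ω * W j ω) (gaussianReal 0 K.toNNReal) ≤
      ENNReal.ofReal (√(2 / (K * Real.pi)) * (√(∫ ω, (K - v - ∑ j, a j ω ^ 2) ^ 2 ∂P) +
          √(∑ j, (∫ ω, a j ω ^ 4 ∂P) * (∫ ω, W j ω ^ 4 ∂P - 1))) +
        1 / K * ∑ j, (∫ ω, |a j ω| ^ 3 ∂P) * ∫ ω, |W j ω| ^ 3 ∂P) := by
  have hsum : Integrable (fun ω => ∑ j, a j ω * W j ω) P :=
    integrable_finsetSum _ fun j _ => (h.memLp_coeff_mul_weight j).integrable (by norm_num)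
  have hind : IndepFun b (fun ω => ∑ j, a j ω * W j ω) P := h.indepFun_bias.comp measurable_id
    (ψ := fun q : (ι → ℝ) × (ι → ℝ) => ∑ i, q.2 i * q.1 i) (by fun_prop)
  refine wassersteinOne_gaussian_add_le hlaw hsum hind hK fun g hg => ?_
  have hcoeff : MemLp (fun ω => K - v - ∑ j, a j ω ^ 2) 2 P := by
    refine (memLp_const _).sub (memLp_finsetSum _ fun j _ => ?_)
    simpa only [pow_two] using memLp_two_mul_of_memLp_four (h.memLp_coeff j) (h.memLp_coeff j)
  have hfluct : MemLp (fun ω => -(∑ j, a j ω ^ 2 * (W j ω ^ 2 - 1))) 2 P :=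
    (memLp_finsetSum _ fun j _ => h.memLp_two_sq_mul_sq_sub_one j).neg
  have hderiv : ∀ ω, |deriv g (b ω + ∑ i, a i ω * W i ω)| ≤ √(2 / (K * Real.pi)) := fun ω =>
    hg.abs_deriv_le _
  have hfluct_le := integral_mul_le_mul_sqrt_integral_sq hfluct hderiv
  simp only [neg_sq, h.integral_sum_sq_mul_sq_sub_one_sq] at hfluct_le
  rw [h.integral_steinOperator_eq hg, mul_add, Finset.mul_sum]
  exact add_le_add (add_le_add (integral_mul_le_mul_sqrt_integral_sq hcoeff hderiv) hfluct_le)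
    (Finset.sum_le_sum fun j _ => h.integral_sq_mul_deriv_comp_sub_le hg hK j)

end IsRandomLinearForm

end LinearForm

section GeneratedSigmaAlgebra

variable {Ω ι α β : Type*} {mΩ : MeasurableSpace Ω} {P : Measure Ω} {mα : MeasurableSpace α}
  {mβ : MeasurableSpace β}

/-- The `σ`-algebra generated by the members of a family of real functions with index in `S`. -/
@[reducible]
def generatedBy (X : ι → Ω → ℝ) (S : Set ι) : MeasurableSpace Ω :=
  ⨆ i ∈ S, MeasurableSpace.comap (X i) inferInstance

theorem generatedBy_mono (X : ι → Ω → ℝ) {S T : Set ι} (h : S ⊆ T) :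
    generatedBy X S ≤ generatedBy X T :=
  biSup_mono h

theorem measurable_generatedBy (X : ι → Ω → ℝ) {S : Set ι} {i : ι} (hi : i ∈ S) :
    Measurable[generatedBy X S] (X i) :=
  (comap_measurable (X i)).mono
    (le_biSup (fun i => MeasurableSpace.comap (X i) inferInstance) hi) le_rfl

-- Unlike in `measurable_pi_lambda`, the `σ`-algebra on `Ω` is found by unification.
theorem measurable_pi_of_measurable_eval {f : Ω → ι → ℝ} (h : ∀ i, Measurable fun ω => f ω i) :
    Measurable f :=
  measurable_pi_lambda _ h

theorem indepFun_of_measurable_generatedBy {X : ι → Ω → ℝ} (h : iIndepFun X P)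
    (hX : ∀ i, Measurable (X i)) {S T : Set ι} (hST : Disjoint S T) {f : Ω → α} {g : Ω → β}
    (hf : Measurable[generatedBy X S] f) (hg : Measurable[generatedBy X T] g) :
    IndepFun f g P := by
  rw [IndepFun_iff_Indep]
  have hind := indep_iSup_of_disjoint (fun i => (hX i).comap_le) h.iIndep hST
  exact indep_of_indep_of_le_left (indep_of_indep_of_le_right hind hg.comap_le) hf.comap_le

end GeneratedSigmaAlgebra

section Network

variable {Ω : Type*} {σ : ℝ → ℝ} {Cb CW : ℝ} {n : ℕ → ℕ}
  {W : (ℓ : ℕ) → Fin (n (ℓ + 1)) → Fin (n ℓ) → Ω → ℝ} {b : (ℓ : ℕ) → Fin (n (ℓ + 1)) → Ω → ℝ}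
  {x : Fin (n 0) → ℝ} {L ℓ : ℕ}

/-- The layer from which the parameter with a given index leads to the next one. -/
def ParamIndex.layer : ParamIndex L n → ℕ
  | Sum.inl q => q.1
  | Sum.inr q => q.1

/-- The index of the weight `W ℓ j k`. -/
def weightIndex (hℓ : ℓ ≤ L) (j : Fin (n (ℓ + 1))) (k : Fin (n ℓ)) : ParamIndex L n :=
  Sum.inl ⟨⟨ℓ, Nat.lt_succ_of_le hℓ⟩, j, k⟩

/-- The index of the bias `b ℓ j`. -/
def biasIndex (hℓ : ℓ ≤ L) (j : Fin (n (ℓ + 1))) : ParamIndex L n :=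
  Sum.inr ⟨⟨ℓ, Nat.lt_succ_of_le hℓ⟩, j⟩

/-- The vector that layer `ℓ` feeds into the next one: the input `x` if `ℓ = 0`, and `σ` applied to
the preactivations otherwise. -/
noncomputable def activation (σ : ℝ → ℝ) (CW : ℝ) (n : ℕ → ℕ)
    (W : (ℓ : ℕ) → Fin (n (ℓ + 1)) → Fin (n ℓ) → Ω → ℝ)
    (b : (ℓ : ℕ) → Fin (n (ℓ + 1)) → Ω → ℝ) (x : Fin (n 0) → ℝ) :
    (ℓ : ℕ) → Fin (n ℓ) → Ω → ℝ
  | 0 => fun j _ => x j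
  | ℓ + 1 => fun j ω => σ (preact σ CW n W b x (ℓ + 1) j ω)

theorem preact_succ (ℓ : ℕ) (j : Fin (n (ℓ + 1))) :
    preact σ CW n W b x (ℓ + 1) j = fun ω => b ℓ j ω +
      ∑ k, (√CW / √(n ℓ) * activation σ CW n W b x ℓ k ω) * W ℓ j k ω := by
  have hpreact : preact σ CW n W b x (ℓ + 1) j = fun ω => b ℓ j ω +
      √CW / √(n ℓ) * ∑ k, W ℓ j k ω * activation σ CW n W b x ℓ k ω := by
    cases ℓ <;> rfl
  simp only [hpreact, Finset.mul_sum, mul_assoc, mul_comm (W ℓ j _ _)]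

theorem measurable_weight_generatedBy (hℓ : ℓ ≤ L) {j k} {S : Set (ParamIndex L n)}
    (hS : weightIndex hℓ j k ∈ S) : Measurable[generatedBy (params L n W b) S] (W ℓ j k) :=
  measurable_generatedBy (params L n W b) hS

theorem measurable_bias_generatedBy (hℓ : ℓ ≤ L) {j} {S : Set (ParamIndex L n)}
    (hS : biasIndex hℓ j ∈ S) : Measurable[generatedBy (params L n W b) S] (b ℓ j) :=
  measurable_generatedBy (params L n W b) hS

theorem measurable_activation_generatedBy (hσ : Measurable σ) (hℓ : ℓ ≤ L + 1) (j) :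
    Measurable[generatedBy (params L n W b) {i | i.layer < ℓ}] (activation σ CW n W b x ℓ j) := by
  induction ℓ with
  | zero => exact measurable_const
  | succ ℓ ih =>
    have hℓL : ℓ ≤ L := by lia
    have hact : ∀ k, Measurable[generatedBy (params L n W b) {i | i.layer < ℓ + 1}]
        (activation σ CW n W b x ℓ k) := fun k =>
      (ih (by lia) k).mono
        (generatedBy_mono _ fun i (hi : i.layer < ℓ) => Nat.lt_succ_of_lt hi) le_rfl
    have hweight : ∀ k, Measurable[generatedBy (params L n W b) {i | i.layer < ℓ + 1}] (W ℓ j k) :=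
      fun k => measurable_weight_generatedBy hℓL (Nat.lt_succ_self ℓ)
    have hbias : Measurable[generatedBy (params L n W b) {i | i.layer < ℓ + 1}] (b ℓ j) :=
      measurable_bias_generatedBy hℓL (Nat.lt_succ_self ℓ)
    refine hσ.comp ?_
    rw [preact_succ]
    exact hbias.add (Finset.measurable_fun_sum _ fun k _ =>
      ((hact k).const_mul _).mul (hweight k))

variable {mΩ : MeasurableSpace Ω} {P : Measure Ω} {ν : Measure ℝ}

namespace IsRandomInit

theorem measurable_params (h : IsRandomInit P L n Cb ν W b) (i : ParamIndex L n) :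
    Measurable (params L n W b i) := by
  rcases i with ⟨ℓ, j, k⟩ | ⟨ℓ, j⟩
  · exact h.measurable_weight ℓ (Nat.le_of_lt_succ ℓ.2) j k
  · exact h.measurable_bias ℓ (Nat.le_of_lt_succ ℓ.2) j

theorem measurable_activation (h : IsRandomInit P L n Cb ν W b) (hσ : Measurable σ)
    (hℓ : ℓ ≤ L + 1) (j) : Measurable (activation σ CW n W b x ℓ j) :=
  (measurable_activation_generatedBy hσ hℓ j).mono
    (iSup₂_le fun i _ => (h.measurable_params i).comap_le) le_rfl

theorem indepFun_bias (h : IsRandomInit P L n Cb ν W b) (hσ : Measurable σ) (hℓ : ℓ ≤ L) (j) :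
    IndepFun (b ℓ j)
      (fun ω => ((fun k => W ℓ j k ω), (fun k => activation σ CW n W b x ℓ k ω))) P := by
  refine indepFun_of_measurable_generatedBy h.indep h.measurable_params
    (S := {biasIndex hℓ j}) (T := {biasIndex hℓ j}ᶜ) disjoint_compl_right
    (measurable_bias_generatedBy hℓ rfl) (Measurable.prodMk
      (measurable_pi_of_measurable_eval fun k => ?_) (measurable_pi_of_measurable_eval fun k => ?_))
  · exact measurable_weight_generatedBy hℓ (by simp [weightIndex, biasIndex])
  · refine (measurable_activation_generatedBy hσ (by lia) k).mono (generatedBy_mono _ ?_) le_rfl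
    rintro i (hi : i.layer < ℓ) rfl
    exact lt_irrefl _ hi

theorem indepFun_weight (h : IsRandomInit P L n Cb ν W b) (hσ : Measurable σ) (hℓ : ℓ ≤ L) (j k) :
    IndepFun (W ℓ j k) (fun ω => (b ℓ j ω, (fun i : {i // i ≠ k} => W ℓ j i ω),
      (fun i => activation σ CW n W b x ℓ i ω))) P := by
  refine indepFun_of_measurable_generatedBy h.indep h.measurable_params
    (S := {weightIndex hℓ j k}) (T := {weightIndex hℓ j k}ᶜ) disjoint_compl_right
    (measurable_weight_generatedBy hℓ rfl) (Measurable.prodMk ?_ (Measurable.prodMk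
      (measurable_pi_of_measurable_eval fun i => ?_)
      (measurable_pi_of_measurable_eval fun i => ?_)))
  · exact measurable_bias_generatedBy hℓ (by simp [weightIndex, biasIndex])
  · exact measurable_weight_generatedBy hℓ (by simpa [weightIndex] using i.2)
  · refine (measurable_activation_generatedBy hσ (by lia) i).mono (generatedBy_mono _ ?_) le_rfl
    rintro i (hi : i.layer < ℓ) rfl
    exact lt_irrefl _ hi

theorem indepFun_row (h : IsRandomInit P L n Cb ν W b) (hσ : Measurable σ) (hℓ : ℓ ≤ L) (j) :
    IndepFun (fun ω k => W ℓ j k ω) (fun ω k => activation σ CW n W b x ℓ k ω) P := by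
  refine indepFun_of_measurable_generatedBy h.indep h.measurable_params
    (S := {i | i.layer = ℓ}) (T := {i | i.layer < ℓ}) ?_
    (measurable_pi_of_measurable_eval fun k => ?_) (measurable_pi_of_measurable_eval fun k => ?_)
  · exact Set.disjoint_left.2 fun i (hi : i.layer = ℓ) (hlt : i.layer < ℓ) => hlt.ne hi
  · exact measurable_weight_generatedBy hℓ rfl
  · exact measurable_activation_generatedBy hσ (by lia) k

theorem iIndepFun_row (h : IsRandomInit P L n Cb ν W b) (hℓ : ℓ ≤ L) (j) :
    iIndepFun (W ℓ j) P :=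
  h.indep.precomp (g := weightIndex hℓ j) fun k k' hk => by simpa [weightIndex] using hk

theorem measurable_joint (h : IsRandomInit P L n Cb ν W b) (hσ : Measurable σ) (hℓ : ℓ ≤ L) (j) :
    Measurable fun ω => (b ℓ j ω, ((fun k => W ℓ j k ω),
      (fun k => activation σ CW n W b x ℓ k ω))) :=
  (h.measurable_bias ℓ hℓ j).prodMk
    ((measurable_pi_lambda _ fun k => h.measurable_weight ℓ hℓ j k).prodMk
      (measurable_pi_lambda _ fun k => h.measurable_activation hσ (by lia) k))

variable [IsProbabilityMeasure P]

theorem map_joint (h : IsRandomInit P L n Cb ν W b) (hσ : Measurable σ) (hℓ : ℓ ≤ L) (j) :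
    P.map (fun ω => (b ℓ j ω, ((fun k => W ℓ j k ω),
      (fun k => activation σ CW n W b x ℓ k ω)))) = (gaussianReal 0 Cb.toNNReal).prod
      ((Measure.pi fun _ => ν).prod (P.map fun ω k => activation σ CW n W b x ℓ k ω)) := by
  have hjoint := h.measurable_joint (CW := CW) (x := x) hσ hℓ j
  rw [(h.indepFun_bias hσ hℓ j).map_prod_eq_prod_map_map hjoint.fst.aemeasurable
      hjoint.snd.aemeasurable, h.law_bias ℓ hℓ,
    (h.indepFun_row hσ hℓ j).map_prod_eq_prod_map_map hjoint.snd.fst.aemeasurable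
      hjoint.snd.snd.aemeasurable,
    (h.iIndepFun_row hℓ j).map_fun_eq_pi_map fun k =>
      (h.measurable_weight ℓ hℓ j k).aemeasurable]
  simp only [h.law_weight ℓ hℓ]

theorem identDistrib_preact (h : IsRandomInit P L n Cb ν W b) (hσ : Measurable σ) (hℓ : ℓ ≤ L)
    (i j) : IdentDistrib (preact σ CW n W b x (ℓ + 1) i) (preact σ CW n W b x (ℓ + 1) j) P P := by
  have hjoint := h.measurable_joint (CW := CW) (x := x) hσ hℓ
  have hident : IdentDistrib _ _ P P := ⟨(hjoint i).aemeasurable, (hjoint j).aemeasurable,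
    (h.map_joint hσ hℓ i).trans (h.map_joint hσ hℓ j).symm⟩
  have hcomp := hident.comp (u := fun q : ℝ × (Fin (n ℓ) → ℝ) × (Fin (n ℓ) → ℝ) =>
    q.1 + ∑ k, √CW / √(n ℓ) * q.2.2 k * q.2.1 k) (by fun_prop)
  simpa only [Function.comp_def, preact_succ] using hcomp

theorem identDistrib_activation (h : IsRandomInit P L n Cb ν W b) (hσ : Measurable σ)
    (hℓ : ℓ ≤ L + 1) (hpos : ℓ ≠ 0) (i j) :
    IdentDistrib (activation σ CW n W b x ℓ i) (activation σ CW n W b x ℓ j) P P := by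
  obtain ⟨m, rfl⟩ := Nat.exists_eq_succ_of_ne_zero hpos
  exact (h.identDistrib_preact hσ (by lia) i j).comp hσ

end IsRandomInit

end Network

section NetworkConstants

theorem exists_nonneg_pow_four_eq {y : ℝ} (hy : 0 ≤ y) :
    ∃ u, 0 ≤ u ∧ u ^ 4 = y ∧ y ^ (3 / 4 : ℝ) = u ^ 3 := by
  refine ⟨y ^ (1 / 4 : ℝ), by positivity, ?_, ?_⟩ <;>
    rw [← Real.rpow_natCast, ← Real.rpow_mul hy] <;> norm_num

theorem three_halves_mul_sqrt_le {s : ℝ} (hs : 0 ≤ s) :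
    3 / 2 * √s ≤ s ^ (3 / 4 : ℝ) + 1 := by
  obtain ⟨u, hu, rfl, hu3⟩ := exists_nonneg_pow_four_eq hs
  have hsqrt : √(u ^ 4) = u ^ 2 := by
    rw [show u ^ 4 = (u ^ 2) ^ 2 by ring, Real.sqrt_sq (sq_nonneg u)]
  rw [hu3, hsqrt]
  nlinarith [mul_nonneg (sq_nonneg (u - 1)) hu, sq_nonneg (u - 1)]

theorem four_mul_sqrt_sub_one_le {m : ℝ} (hm : 0 ≤ m) :
    4 * √(m - 1) ≤ 3 * m ^ (3 / 4 : ℝ) := by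
  obtain ⟨v, hv, rfl, hv3⟩ := exists_nonneg_pow_four_eq hm
  rw [hv3, ← le_div_iff₀' (by norm_num)]
  refine Real.sqrt_le_iff.2 ⟨by positivity, ?_⟩
  nlinarith [mul_nonneg (sq_nonneg (v ^ 2 - 6 / 5)) (sq_nonneg v), sq_nonneg (v ^ 2 - 6 / 5)]

theorem two_mul_sqrt_mul_sub_one_le {m s : ℝ} (hm : 0 ≤ m) (hs : 0 ≤ s) :
    2 * √(s * (m - 1)) ≤ m ^ (3 / 4 : ℝ) * (s ^ (3 / 4 : ℝ) + 1) := by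
  calc 2 * √(s * (m - 1)) = 1 / 3 * (4 * √(m - 1)) * (3 / 2 * √s) := by
        rw [Real.sqrt_mul hs]
        ring
    _ ≤ 1 / 3 * (3 * m ^ (3 / 4 : ℝ)) * (s ^ (3 / 4 : ℝ) + 1) := by
        gcongr 1 / 3 * ?_ * ?_
        exacts [four_mul_sqrt_sub_one_le hm, three_halves_mul_sqrt_le hs]
    _ = m ^ (3 / 4 : ℝ) * (s ^ (3 / 4 : ℝ) + 1) := by ring

theorem sqrt_two_div_mul_pi {K : ℝ} (hK : 0 < K) :
    √(2 / (K * Real.pi)) = 2 / (√K * √(2 * Real.pi)) := by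
  rw [← Real.sqrt_mul hK.le, eq_div_iff (by positivity), ← Real.sqrt_mul (by positivity),
    show 2 / (K * Real.pi) * (K * (2 * Real.pi)) = 2 ^ 2 by field_simp,
    Real.sqrt_sq (by norm_num)]

theorem sqrt_sum_fourth_moment_le {C N K m s : ℝ} (hC : 0 ≤ C) (hN : 0 < N) (hK : 0 < K)
    (hm : 0 ≤ m) (hs : 0 ≤ s) :
    √(2 / (K * Real.pi)) * √(N * ((√C / √N) ^ 4 * s * (m - 1))) ≤
      C / (√N * √K) * m ^ (3 / 4 : ℝ) * (s ^ (3 / 4 : ℝ) + 1) * (1 / √(2 * Real.pi)) := by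
  have hsq : (√C / √N) ^ 2 = C / N := by rw [div_pow, Real.sq_sqrt hC, Real.sq_sqrt hN.le]
  have hradicand : N * ((√C / √N) ^ 4 * s * (m - 1)) = (C / √N) ^ 2 * (s * (m - 1)) := by
    rw [show (√C / √N) ^ 4 = ((√C / √N) ^ 2) ^ 2 by ring, hsq, div_pow C √N, Real.sq_sqrt hN.le]
    field_simp
  calc √(2 / (K * Real.pi)) * √(N * ((√C / √N) ^ 4 * s * (m - 1)))
      = C / (√N * √K) * (2 * √(s * (m - 1))) * (1 / √(2 * Real.pi)) := by
        rw [sqrt_two_div_mul_pi hK, hradicand, Real.sqrt_mul (sq_nonneg _),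
          Real.sqrt_sq (by positivity)]
        ring
    _ ≤ C / (√N * √K) * (m ^ (3 / 4 : ℝ) * (s ^ (3 / 4 : ℝ) + 1)) * (1 / √(2 * Real.pi)) := by
        gcongr _ * ?_ * _
        exact two_mul_sqrt_mul_sub_one_le hm hs
    _ = C / (√N * √K) * m ^ (3 / 4 : ℝ) * (s ^ (3 / 4 : ℝ) + 1) * (1 / √(2 * Real.pi)) := by
        ring

theorem sum_third_moment_le {C N K m s m₃ s₃ : ℝ} (hC : 0 ≤ C) (hN : 0 < N) (hK : 0 < K)
    (hm : 0 ≤ m) (hs₃ : 0 ≤ s₃) (hm₃ : m₃ ≤ m ^ (3 / 4 : ℝ)) (hs : s₃ ≤ s ^ (3 / 4 : ℝ)) :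
    1 / K * (N * ((√C / √N) ^ 3 * s₃ * m₃)) ≤
      C / (√N * √K) * m ^ (3 / 4 : ℝ) * (s ^ (3 / 4 : ℝ) + 1) * (4 * √C / √K) := by
  have hfactor : 1 / K * (N * (√C / √N) ^ 3) = C / (√N * √K) * (√C / √K) := by
    have hC' : √C ^ 3 = C * √C := by rw [pow_succ, Real.sq_sqrt hC]
    have hN' : √N ^ 3 = N * √N := by rw [pow_succ, Real.sq_sqrt hN.le]
    have hK' : K = √K * √K := (Real.mul_self_sqrt hK.le).symm
    rw [div_pow, hC', hN', hK', Real.sqrt_mul_self (Real.sqrt_nonneg K)]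
    field_simp
  have hs' := hs₃.trans hs
  calc 1 / K * (N * ((√C / √N) ^ 3 * s₃ * m₃))
      = C / (√N * √K) * m₃ * s₃ * (√C / √K) := by
        linear_combination s₃ * m₃ * hfactor
    _ ≤ C / (√N * √K) * m ^ (3 / 4 : ℝ) * (s ^ (3 / 4 : ℝ) + 1) * (4 * √C / √K) := by
        gcongr ?_ * ?_ * ?_ * (?_ / √K)
        · linarith
        · linarith [Real.sqrt_nonneg C]

end NetworkConstants

section NetworkBound

variable {Ω : Type*} {mΩ : MeasurableSpace Ω} {P : Measure Ω} {σ : ℝ → ℝ} {Cb CW : ℝ} {n : ℕ → ℕ}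
  {W : (ℓ : ℕ) → Fin (n (ℓ + 1)) → Fin (n ℓ) → Ω → ℝ} {b : (ℓ : ℕ) → Fin (n (ℓ + 1)) → Ω → ℝ}
  {x : Fin (n 0) → ℝ} {L ℓ : ℕ} {ν : Measure ℝ}

section LimitVariance

variable [∀ ℓ, NeZero (n ℓ)]

theorem limitVar_nonneg (hCb : 0 ≤ Cb) (hCW : 0 ≤ CW) :
    ∀ ℓ, 0 ≤ limitVar P σ Cb CW n W b x ℓ
  | 0 | 1 => le_rfl
  | 2 | _ + 3 => add_nonneg hCb (mul_nonneg hCW (integral_nonneg fun _ => sq_nonneg _))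

theorem fluctuation_two_eq (hCW : 0 ≤ CW) (ℓ : ℕ) :
    fluctuation P σ Cb CW n W b x 2 (ℓ + 1) = ∫ ω, (limitVar P σ Cb CW n W b x (ℓ + 2) - Cb -
      ∑ k, (√CW / √(n (ℓ + 1)) * activation σ CW n W b x (ℓ + 1) k ω) ^ 2) ^ 2 ∂P := by
  have hsq : (√CW / √(n (ℓ + 1))) ^ 2 = CW / n (ℓ + 1) := by
    rw [div_pow, Real.sq_sqrt hCW, Real.sq_sqrt (Nat.cast_nonneg _)]
  simp only [fluctuation, activation, sq_abs, mul_pow, hsq]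
  congr with ω
  ring

end LimitVariance

namespace IsRandomInit

theorem integral_comp_weight (h : IsRandomInit P L n Cb ν W b) (hℓ : ℓ ≤ L) (j k) {f : ℝ → ℝ}
    (hf : Measurable f) : ∫ ω, f (W ℓ j k ω) ∂P = ∫ w, f w ∂ν := by
  rw [← h.law_weight ℓ hℓ j k,
    integral_map (h.measurable_weight ℓ hℓ j k).aemeasurable hf.aestronglyMeasurable]

theorem isRandomLinearForm (h : IsRandomInit P L n Cb ν W b) (hσ : Measurable σ) (hℓ : ℓ ≤ L)
    (hν : MemLp id 4 ν) (ha : ∀ k, MemLp (activation σ CW n W b x ℓ k) 4 P) (c : ℝ) (j) :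
    IsRandomLinearForm P (b ℓ j) (W ℓ j) fun k ω => c * activation σ CW n W b x ℓ k ω where
  measurable_bias := h.measurable_bias ℓ hℓ j
  measurable_weight := h.measurable_weight ℓ hℓ j
  measurable_coeff k := (h.measurable_activation hσ (by lia) k).const_mul c
  memLp_weight k := by
    rw [← h.law_weight ℓ hℓ j k] at hν
    exact hν.comp_of_map (h.measurable_weight ℓ hℓ j k).aemeasurable
  memLp_coeff k := (ha k).const_mul c
  integral_weight k := (h.integral_comp_weight hℓ j k measurable_id).trans h.mean_zero
  integral_weight_sq k :=
    (h.integral_comp_weight hℓ j k (measurable_id.pow_const 2)).trans h.var_one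
  indepFun_bias := (h.indepFun_bias hσ hℓ j).comp measurable_id
    (ψ := fun q : (Fin (n ℓ) → ℝ) × (Fin (n ℓ) → ℝ) => (q.1, fun k => c * q.2 k)) (by fun_prop)
  indepFun_weight k := (h.indepFun_weight hσ hℓ j k).comp measurable_id
    (ψ := fun q : ℝ × ({i // i ≠ k} → ℝ) × (Fin (n ℓ) → ℝ) =>
      (q.1, q.2.1, fun i => c * q.2.2 i)) (by fun_prop)

variable [IsProbabilityMeasure P]

theorem integral_comp_activation (h : IsRandomInit P L n Cb ν W b) (hσ : Measurable σ)
    (hℓ : ℓ ≤ L + 1) (hpos : ℓ ≠ 0) (i j) {f : ℝ → ℝ} (hf : Measurable f) :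
    ∫ ω, f (activation σ CW n W b x ℓ i ω) ∂P = ∫ ω, f (activation σ CW n W b x ℓ j ω) ∂P :=
  ((h.identDistrib_activation hσ hℓ hpos i j).comp hf).integral_eq

variable [∀ ℓ, NeZero (n ℓ)]

theorem wassersteinOne_preact_le_moments (h : IsRandomInit P L n Cb ν W b) (hCb : 0 ≤ Cb)
    (hσ : Measurable σ) (hℓ : ℓ ≤ L) (hpos : ℓ ≠ 0) (hν : MemLp id 4 ν)
    (ha : MemLp (activation σ CW n W b x ℓ 0) 4 P) {K : ℝ} (hK : 0 < K) (j) :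
    wassersteinOne (P.map (preact σ CW n W b x (ℓ + 1) j)) (gaussianReal 0 K.toNNReal) ≤
      ENNReal.ofReal (√(2 / (K * Real.pi)) *
          (√(∫ ω, (K - Cb - ∑ k, (√CW / √(n ℓ) * activation σ CW n W b x ℓ k ω) ^ 2) ^ 2 ∂P) +
            √(n ℓ * ((√CW / √(n ℓ)) ^ 4 * (∫ ω, activation σ CW n W b x ℓ 0 ω ^ 4 ∂P) *
              (∫ w, w ^ 4 ∂ν - 1)))) +
        1 / K * (n ℓ * ((√CW / √(n ℓ)) ^ 3 * (∫ ω, |activation σ CW n W b x ℓ 0 ω| ^ 3 ∂P) *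
          ∫ w, |w| ^ 3 ∂ν))) := by
  have hℓ' : ℓ ≤ L + 1 := by lia
  have hform := h.isRandomLinearForm (CW := CW) (x := x) hσ hℓ hν
    (fun k => (h.identDistrib_activation hσ hℓ' hpos k 0).memLp_iff.2 ha) (√CW / √(n ℓ)) j
  have hcoeff₄ : ∀ k, ∫ ω, (√CW / √(n ℓ) * activation σ CW n W b x ℓ k ω) ^ 4 ∂P =
      (√CW / √(n ℓ)) ^ 4 * ∫ ω, activation σ CW n W b x ℓ 0 ω ^ 4 ∂P := fun k => by
    simp only [mul_pow, integral_const_mul]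
    rw [h.integral_comp_activation hσ hℓ' hpos k 0 (f := fun t => t ^ 4) (by fun_prop)]
  have hcoeff₃ : ∀ k, ∫ ω, |√CW / √(n ℓ) * activation σ CW n W b x ℓ k ω| ^ 3 ∂P =
      (√CW / √(n ℓ)) ^ 3 * ∫ ω, |activation σ CW n W b x ℓ 0 ω| ^ 3 ∂P := fun k => by
    simp only [abs_mul, mul_pow, integral_const_mul]
    rw [h.integral_comp_activation hσ hℓ' hpos k 0 (f := fun t => |t| ^ 3) (by fun_prop),
      abs_of_nonneg (by positivity)]
  have hweight₄ : ∀ k, ∫ ω, W ℓ j k ω ^ 4 ∂P = ∫ w, w ^ 4 ∂ν := fun k =>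
    h.integral_comp_weight hℓ j k (f := fun t => t ^ 4) (by fun_prop)
  have hweight₃ : ∀ k, ∫ ω, |W ℓ j k ω| ^ 3 ∂P = ∫ w, |w| ^ 3 ∂ν := fun k =>
    h.integral_comp_weight hℓ j k (f := fun t => |t| ^ 3) (by fun_prop)
  have hbound := hform.wassersteinOne_add_sum_le (h.law_bias ℓ hℓ j) hK
  simp only [hcoeff₄, hcoeff₃, hweight₄, hweight₃, Real.coe_toNNReal _ hCb, Finset.sum_const,
    Finset.card_univ, Fintype.card_fin, nsmul_eq_mul] at hbound
  rwa [preact_succ]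

theorem wassersteinOne_preact_le (h : IsRandomInit P L n Cb ν W b) (hCb : 0 ≤ Cb) (hCW : 0 ≤ CW)
    (hσ : Measurable σ) (hℓ : ℓ + 1 ≤ L) (hν : MemLp id 4 ν)
    (ha : MemLp (activation σ CW n W b x (ℓ + 1) 0) 4 P) {K : ℝ}
    (hKdef : K = limitVar P σ Cb CW n W b x (ℓ + 2)) (hK : K ≠ 0) (j) :
    wassersteinOne (P.map (preact σ CW n W b x (ℓ + 2) j)) (gaussianReal 0 K.toNNReal) ≤
      ENNReal.ofReal (CW / (√(n (ℓ + 1)) * √K) * (∫ w, w ^ 4 ∂ν) ^ (3 / 4 : ℝ)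
          * ((∫ ω, |activation σ CW n W b x (ℓ + 1) 0 ω| ^ 4 ∂P) ^ (3 / 4 : ℝ) + 1)
          * (4 * √CW / √K + 1 / √(2 * Real.pi))
        + √(2 / (K * Real.pi)) * √(fluctuation P σ Cb CW n W b x 2 (ℓ + 1))) := by
  have hK0 : 0 < K := lt_of_le_of_ne (hKdef ▸ limitVar_nonneg hCb hCW _) hK.symm
  have hn : 0 < (n (ℓ + 1) : ℝ) := Nat.cast_pos.2 (NeZero.pos _)
  have hprob : IsProbabilityMeasure ν := h.law_weight (ℓ + 1) hℓ 0 0 ▸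
    Measure.isProbabilityMeasure_map (h.measurable_weight _ hℓ 0 0).aemeasurable
  have hweight₃ := integral_abs_pow_le (p := 3) (q := 4) (by norm_num) (by norm_num) hν
  have hact₃ := integral_abs_pow_le (p := 3) (q := 4) (by norm_num) (by norm_num) ha
  simp only [Even.pow_abs (n := 4) (by decide), id, Nat.cast_ofNat] at hweight₃ hact₃ ⊢
  have hm : 0 ≤ ∫ w, w ^ 4 ∂ν := integral_nonneg fun w => by positivity
  have hs : 0 ≤ ∫ ω, activation σ CW n W b x (ℓ + 1) 0 ω ^ 4 ∂P :=
    integral_nonneg fun ω => by positivity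
  have hfourth := sqrt_sum_fourth_moment_le hCW hn hK0 hm hs
  have hthird := sum_third_moment_le hCW hn hK0 hm
    (integral_nonneg fun ω => by positivity) hweight₃ hact₃
  refine (h.wassersteinOne_preact_le_moments hCb hσ hℓ (Nat.succ_ne_zero ℓ) hν ha hK0 j).trans
    (ENNReal.ofReal_le_ofReal ?_)
  rw [fluctuation_two_eq hCW, ← hKdef, mul_add, mul_add (_ * _ * _) (4 * √CW / √K)]
  linarith

end IsRandomInit

end NetworkBound

end

theorem mainTheorem7_general {Ω : Type*} [MeasurableSpace Ω] (P : Measure Ω)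
    [IsProbabilityMeasure P] (Cb : ℝ) (hCb : 0 ≤ Cb) :
    (∀ (CW : ℝ), 0 < CW → ∀ (σ : ℝ → ℝ), Measurable σ →
      ∀ (L : ℕ), 1 ≤ L → ∀ (n : ℕ → ℕ) [∀ ℓ, NeZero (n ℓ)]
        (W : (ℓ : ℕ) → Fin (n (ℓ + 1)) → Fin (n ℓ) → Ω → ℝ)
        (b : (ℓ : ℕ) → Fin (n (ℓ + 1)) → Ω → ℝ) (ν : Measure ℝ) (x : Fin (n 0) → ℝ),
      IsRandomInit P L n Cb ν W b →
      Integrable (fun w : ℝ => w ^ 4) ν →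
      Integrable (fun ω => |σ (preact σ CW n W b x L 0 ω)| ^ 4) P →
      ∀ (K : ℝ), K = limitVar P σ Cb CW n W b x (L + 1) → K ≠ 0 →
      wassersteinOne (P.map (preact σ CW n W b x (L + 1) 0)) (gaussianReal 0 K.toNNReal) ≤
        ENNReal.ofReal
          (CW / (√(n L) * √K) * (∫ w, w ^ 4 ∂ν) ^ (3 / 4 : ℝ)
              * ((∫ ω, |σ (preact σ CW n W b x L 0 ω)| ^ 4 ∂P) ^ (3 / 4 : ℝ) + 1)
              * (4 * √CW / √K + 1 / √(2 * Real.pi))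
            + √(2 / (K * Real.pi)) * √(fluctuation P σ Cb CW n W b x 2 L))) ∧
    (∀ {E : Type*} [MeasurableSpace E] (k : ℕ) (f : (Fin k → E) → ℝ) (X X' : Fin k → Ω → E)
        (b : Ω → ℝ) (K : ℝ),
      Measurable f → (∀ i, Measurable (X i)) → (∀ i, Measurable (X' i)) → Measurable b →
      0 < K →
      P.map b = gaussianReal 0 Cb.toNNReal →
      iIndepFun X P →
      P.map (fun ω i => X' i ω) = P.map (fun ω i => X i ω) →
      IndepFun (fun ω i => X i ω) (fun ω i => X' i ω) P →
      IndepFun b (fun ω => ((fun i => X i ω), (fun i => X' i ω))) P →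
      Integrable (fun ω => f (fun i => X i ω) ^ 4) P →
      ∫ ω, f (fun i => X i ω) ∂P = 0 →
      ∀ (V : Ω → ℝ), V = (fun ω => b ω + f (fun i => X i ω)) →
      wassersteinOne (P.map V) (gaussianReal 0 K.toNNReal) ≤
        ENNReal.ofReal
          (√(2 / (K * Real.pi)) *
              √(∫ ω, (P[fun ω' => K - Cb - steinT f (fun i => X i ω') (fun i => X' i ω')
                  | MeasurableSpace.comap V inferInstance]) ω ^ 2 ∂P)
            + 1 / (2 * K) * ∑ j, ∫ ω,
                |discreteDiff f (fun i => X' i ω) j (fun i => X i ω)| ^ 3 ∂P)) := by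
  refine ⟨?_, ?_⟩
  · intro CW hCW σ hσ L hL n _ W b ν x h hν hact K hKdef hK
    obtain ⟨m, rfl⟩ := Nat.exists_eq_add_of_le' hL
    have hactMeas : Measurable (activation σ CW n W b x (m + 1) 0) :=
      h.measurable_activation hσ (Nat.le_succ _) 0
    have hact₄ : MemLp (activation σ CW n W b x (m + 1) 0) 4 P :=
      (memLp_four_iff_integrable_pow hactMeas.aestronglyMeasurable).2
        (by simpa only [activation, Even.pow_abs (n := 4) (by decide)] using hact)
    exact h.wassersteinOne_preact_le hCb hCW.le hσ le_rfl
      ((memLp_four_iff_integrable_pow aestronglyMeasurable_id).2 hν) hact₄ hKdef hK 0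
  · rintro E _ k f X X' b K hf hX hX' hb hK hlaw hind hcopy hXX' hbX hL hmean V rfl
    have h : IsResamplingPair P X X' b := ⟨hX, hX', hb, hind, hcopy, hXX', hbX⟩
    simpa only [Real.coe_toNNReal _ hCb] using h.wassersteinOne_add_le hK hlaw hf hL hmean

theorem mainTheorem7 {Ω : Type*} [MeasurableSpace Ω] (P : Measure Ω) [IsProbabilityMeasure P]
    (Cb : ℝ) (hCb : 0 ≤ Cb) :
    -- the network bound
    (∀ (CW : ℝ), 0 < CW → ∀ (σ : ℝ → ℝ), Measurable σ →
      ∀ (L : ℕ), 1 ≤ L → ∀ (n : ℕ → ℕ) [∀ ℓ, NeZero (n ℓ)]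
        (W : (ℓ : ℕ) → Fin (n (ℓ + 1)) → Fin (n ℓ) → Ω → ℝ)
        (b : (ℓ : ℕ) → Fin (n (ℓ + 1)) → Ω → ℝ) (ν : Measure ℝ) (x : Fin (n 0) → ℝ),
      IsRandomInit P L n Cb ν W b →
      Integrable (fun w : ℝ => w ^ 4) ν →
      Integrable (fun ω => |σ (preact σ CW n W b x L 0 ω)| ^ 4) P →
      ∀ (K : ℝ), K = limitVar P σ Cb CW n W b x (L + 1) → K ≠ 0 →
      wassersteinOne (P.map (preact σ CW n W b x (L + 1) 0)) (gaussianReal 0 K.toNNReal) ≤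
        ENNReal.ofReal
          (CW / (√(n L) * √K) * (∫ w, w ^ 4 ∂ν) ^ (3 / 4 : ℝ)
              * ((∫ ω, |σ (preact σ CW n W b x L 0 ω)| ^ 4 ∂P) ^ (3 / 4 : ℝ) + 1)
              * (4 * √CW / √K + 1 / √(2 * Real.pi))
            + √(2 / (K * Real.pi)) * √(fluctuation P σ Cb CW n W b x 2 L))) ∧
    -- the normal approximation bound for a function of independent variables plus a Gaussian bias
    (∀ {E : Type*} [TopologicalSpace E] [PolishSpace E] [MeasurableSpace E] [BorelSpace E]
        (k : ℕ) (f : (Fin k → E) → ℝ) (X X' : Fin k → Ω → E) (b : Ω → ℝ) (K : ℝ),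
      Measurable f → (∀ i, Measurable (X i)) → (∀ i, Measurable (X' i)) → Measurable b →
      0 < K →
      P.map b = gaussianReal 0 Cb.toNNReal →
      -- `X` has independent entries, `X'` is an independent copy of it, and `b` is independent of both
      iIndepFun X P →
      P.map (fun ω i => X' i ω) = P.map (fun ω i => X i ω) →
      IndepFun (fun ω i => X i ω) (fun ω i => X' i ω) P →
      IndepFun b (fun ω => ((fun i => X i ω), (fun i => X' i ω))) P →
      Integrable (fun ω => f (fun i => X i ω) ^ 4) P →
      ∫ ω, f (fun i => X i ω) ∂P = 0 →
      ∀ (V : Ω → ℝ), V = (fun ω => b ω + f (fun i => X i ω)) →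
      wassersteinOne (P.map V) (gaussianReal 0 K.toNNReal) ≤
        ENNReal.ofReal
          (√(2 / (K * Real.pi)) *
              √(∫ ω, (P[fun ω' => K - Cb - steinT f (fun i => X i ω') (fun i => X' i ω')
                  | MeasurableSpace.comap V inferInstance]) ω ^ 2 ∂P)
            + 1 / (2 * K) * ∑ j, ∫ ω,
                |discreteDiff f (fun i => X' i ω) j (fun i => X i ω)| ^ 3 ∂P)) :=
  (mainTheorem7_general P Cb hCb).imp_right fun h {E} _ _ _ _ => @h E _
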